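/- **Setting.** Let $\mathcal H=L^2(\mathbb R,dx)$ with inner product antilinear in the first argument. For $z=(q+ip)/\sqrt2\in\mathbb C$ let $D(z)$ be the unitary displacement operator $(D(z)\varphi)(x)=e^{ip(x-q/2)}\varphi(x-q)$. On Schwartz functions let $(Q\varphi)(x)=x\varphi(x)$, $P\varphi=-i\varphi'$, $a=(Q+iP)/\sqrt2$, $a^\dagger=(Q-iP)/\sqrt2$, so that formally $D(z)=e^{za^\dagger-\bar z a}$. Fix a common dense invariant domain $\mathcal D$: a linear space of Schwartz functions, dense in $\mathcal H$, with $Q\mathcal D\subset\mathcal D$ and $P\mathcal D\subset\mathcal D$ (for instance all Schwartz functions, or the finite linear combinations of Hermite functions). A *weight* is a function $\varpi:\mathbb C\to\mathbb C$ with $\varpi(0)=1$, continuous at $0$, such that $w\mapsto\varpi(w)\langle\varphi,D(w)\psi\rangle$ is integrable on $\mathbb C$ for all $\varphi,\psi\in\mathcal D$. It defines $\mathsf M=\int_{\mathbb C}\varpi(w)D(w)\,\frac{d^2w}{\pi}$ in the weak sense, and $\mathsf M(z)=D(z)\mathsf M D(z)^\dagger$, with matrix elements $\langle\varphi,\mathsf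 M(z)\psi\rangle=\int_{\mathbb C}\varpi(w)\,\langle D(z)^\dagger\varphi,D(w)D(z)^\dagger\psi\rangle\,\frac{d^2w}{\pi}$. The weight is *regular* if it is even, $\varpi(-z)=\varpi(z)$, and real, $\overline{\varpi(z)}=\varpi(z)$. For $f:\mathbb C\to\mathbb C$ and $\varphi,\psi\in\mathcal D$ put $$B_f(\varphi,\psi)=\int_{\mathbb C}\langle\varphi,\mathsf M(z)\psi\rangle f(z)\,\frac{d^2z}{\pi}:=\lim_{\varepsilon\to0^+}\int_{\mathbb C}e^{-\varepsilon|z|^2}\langle\varphi,\mathsf M(z)\psi\rangle f(z)\,\frac{d^2z}{\pi},$$ whenever the integrals on the right converge absolutely for all $\varepsilon>0$ and the limit exists (this is the Lebesgue integral if the latter converges absolutely). The quantization $A_f=\int_{\mathbb C}\mathsf M(z)f(z)\frac{d^2z}\pi$ of $f$ is the operator whose domain consists of the $\psi\in\mathcal D$ for which there is $\chi\in\mathcal H$ with $B_f(\varphi,\psi)=\langle\varphi,\chi\rangle$ for all $\varphi\in\mathcal D$, and $A_f\psi=\chi$. **Theorem.** Let $\varpi$ be a regular weight. Then: 1. $A_z=a$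 and $A_{\bar z}=a^\dagger$, as operators with domain $\mathcal D$. 2. $A_{\bar f}=A_f^\dagger$ for every $f:\mathbb C\to\mathbb C$, in the following sense: for $\varphi,\psi\in\mathcal D$, if $B_f(\psi,\varphi)$ exists, then $B_{\bar f}(\varphi,\psi)$ exists and equals $\overline{B_f(\psi,\varphi)}$; the operators $A_f$ and $A_{\bar f}$ are formal adjoints of each other, $\langle A_f\varphi,\psi\rangle=\langle\varphi,A_{\bar f}\psi\rangle$ on their domains; and if $A_f$ is defined on all of $\mathcal D$, then $A_{\bar f}$ is the restriction to $\mathcal D$ of the Hilbert space adjoint $A_f^\dagger$, that is, its domain is exactly $\mathcal D\cap\mathrm{dom}(A_f^\dagger)$ and it coincides with $A_f^\dagger$ there. 3. With $q=\sqrt2\,\mathrm{Re}\,z$ and $p=\sqrt2\,\mathrm{Im}\,z$, $A_q=\dfrac{a+a^\dagger}{\sqrt2}=Q$ and $A_p=\dfrac{a-a^\dagger}{i\sqrt2}=P$, as operators with domain $\mathcal D$. 4. The canonical commutation rules hold on $\mathcal D$: $[A_z,A_{\bar z}]=I$ and $[A_q,A_p]=iI$. This applies to a whole family of quantizations: every bounded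 measurable function $\varpi$ that is even and real, continuous at $0$ and has $\varpi(0)=1$ is a regular weight. -/

import Mathlib

open MeasureTheory Filter Topology
open scoped SchwartzMap ComplexConjugate InnerProductSpace

namespace WHQuant

noncomputable section

/-- The Hilbert space `L²(ℝ, dx)`. -/
abbrev H : Type := Lp ℂ 2 (volume : Measure ℝ)

/-- The invariant measure `d²z / π` on the phase space `ℂ`. -/
def ν : Measure ℂ := ENNReal.ofReal (1 / Real.pi) • (volume : Measure ℂ)

/-! ### The displacement operators -/

/-- The function `x ↦ e^{i p (x - q / 2)} φ (x - q)`, where `z = (q + i p) / √2`. -/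
def dispFun (z : ℂ) (φ : ℝ → ℂ) (x : ℝ) : ℂ :=
  Complex.exp (Complex.I *
      ((Real.sqrt 2 * z.im * (x - Real.sqrt 2 * z.re / 2) : ℝ) : ℂ)) *
    φ (x - Real.sqrt 2 * z.re)

theorem norm_dispFun (z : ℂ) (φ : ℝ → ℂ) (x : ℝ) :
    ‖dispFun z φ x‖ = ‖φ (x - Real.sqrt 2 * z.re)‖ := by
  rw [dispFun, norm_mul, mul_comm Complex.I, Complex.norm_exp_ofReal_mul_I, one_mul]

theorem memLp_shift (c : ℝ) (φ : H) : MemLp (fun x : ℝ => φ (x - c)) 2 volume :=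
  (Lp.memLp φ).comp_measurePreserving (measurePreserving_sub_right volume c)

theorem memLp_dispFun (z : ℂ) (φ : H) : MemLp (dispFun z φ) 2 volume := by
  have h := memLp_shift (Real.sqrt 2 * z.re) φ
  refine h.of_le (AEStronglyMeasurable.mul (Continuous.aestronglyMeasurable (by fun_prop)) h.1)
    (Eventually.of_forall fun x => (norm_dispFun z φ x).le)

theorem ae_shift {p : ℝ → Prop} (c : ℝ) (h : ∀ᵐ x : ℝ, p x) : ∀ᵐ x : ℝ, p (x - c) :=
  (measurePreserving_sub_right volume c).quasiMeasurePreserving.ae h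

/-- The displacement operator `D(z) = e^{z a† - z̄ a}` on `L²(ℝ)`, an isometry:
`(D(z) φ)(x) = e^{i p (x - q / 2)} φ (x - q)`, where `z = (q + i p) / √2`. -/
def Diso (z : ℂ) : H →ₗᵢ[ℂ] H where
  toFun φ := (memLp_dispFun z φ).toLp (dispFun z φ)
  map_add' φ ψ := by
    rw [← MemLp.toLp_add]
    refine MemLp.toLp_congr _ _ ?_
    filter_upwards [ae_shift (Real.sqrt 2 * z.re) (Lp.coeFn_add φ ψ)] with x hx
    simp only [dispFun, Pi.add_apply] at hx ⊢
    rw [hx, mul_add]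
  map_smul' c φ := by
    rw [RingHom.id_apply, ← MemLp.toLp_const_smul]
    refine MemLp.toLp_congr _ _ ?_
    filter_upwards [ae_shift (Real.sqrt 2 * z.re) (Lp.coeFn_smul c φ)] with x hx
    simp only [dispFun, Pi.smul_apply, smul_eq_mul] at hx ⊢
    rw [hx]; ring
  norm_map' φ := by
    change ‖(memLp_dispFun z φ).toLp (dispFun z φ)‖ = ‖φ‖
    rw [Lp.norm_toLp, Lp.norm_def]
    congr 1
    rw [eLpNorm_congr_norm_ae (Eventually.of_forall (norm_dispFun z φ))]
    exact eLpNorm_comp_measurePreserving (Lp.memLp φ).1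
      (measurePreserving_sub_right volume (Real.sqrt 2 * z.re))

/-- The displacement operator `D(z)` as a bounded operator. -/
def D (z : ℂ) : H →L[ℂ] H := (Diso z).toContinuousLinearMap

/-- The adjoint `D(z)†`. -/
def Dadj (z : ℂ) : H →L[ℂ] H := ContinuousLinearMap.adjoint (D z)

theorem coeFn_D (z : ℂ) (φ : H) : D z φ =ᵐ[volume] dispFun z φ :=
  (memLp_dispFun z φ).coeFn_toLp

/-- Addition formula `D(z) D(w) = e^{(z w̄ - z̄ w) / 2} D(z + w)`. -/
theorem D_D (z w : ℂ) (φ : H) :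
    D z (D w φ) = Complex.exp ((z * conj w - conj z * w) / 2) • D (z + w) φ := by
  apply Lp.ext
  filter_upwards [coeFn_D z (D w φ), ae_shift (Real.sqrt 2 * z.re) (coeFn_D w φ),
    coeFn_D (z + w) φ,
    Lp.coeFn_smul (Complex.exp ((z * conj w - conj z * w) / 2)) (D (z + w) φ)] with x h1 h2 h3 h4
  rw [h1, h4, Pi.smul_apply, h3]
  simp only [dispFun, smul_eq_mul] at h2 ⊢
  rw [h2, ← mul_assoc, ← mul_assoc, ← Complex.exp_add, ← Complex.exp_add]
  have hs : (Real.sqrt 2) * (Real.sqrt 2) = 2 := Real.mul_self_sqrt (by norm_num)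
  have hx : x - Real.sqrt 2 * z.re - Real.sqrt 2 * w.re = x - Real.sqrt 2 * (z + w).re := by
    simp; ring
  rw [hx]
  congr 2
  have hphase : (z * conj w - conj z * w) / 2
      = Complex.I * ((z.im * w.re - z.re * w.im : ℝ) : ℂ) := by
    apply Complex.ext
    · simp [mul_comm]
    · simp; ring
  rw [hphase, ← mul_add, ← mul_add, ← Complex.ofReal_add, ← Complex.ofReal_add]
  congr 2
  simp only [Complex.add_re, Complex.add_im]
  linear_combination (z.im * w.re / 2 - w.im * z.re / 2) * hs

theorem D_zero (φ : H) : D 0 φ = φ := by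
  apply Lp.ext
  filter_upwards [coeFn_D 0 φ] with x h
  rw [h]; simp [dispFun]

theorem D_D_neg (z : ℂ) (φ : H) : D z (D (-z) φ) = φ := by
  rw [D_D, add_neg_cancel, D_zero]
  simp [mul_comm]

theorem inner_D_D (z : ℂ) (φ ψ : H) : ⟪D z φ, D z ψ⟫_ℂ = ⟪φ, ψ⟫_ℂ :=
  (Diso z).inner_map_map φ ψ

theorem adjoint_D (z : ℂ) (φ : H) : Dadj z φ = D (-z) φ := by
  refine ext_inner_left ℂ fun v => ?_
  rw [Dadj, ContinuousLinearMap.adjoint_inner_right, ← inner_D_D z v, D_D_neg]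

/-- The covariance formula `D(z) D(w) D(z)† = e^{z w̄ - z̄ w} D(w)`, in weak form. -/
theorem inner_displaced (z w : ℂ) (φ ψ : H) :
    ⟪Dadj z φ, D w (Dadj z ψ)⟫_ℂ
      = Complex.exp (z * conj w - conj z * w) * ⟪φ, D w ψ⟫_ℂ := by
  rw [adjoint_D z ψ, Dadj, ContinuousLinearMap.adjoint_inner_left, D_D, inner_smul_right, D_D,
    inner_smul_right, ← mul_assoc, ← Complex.exp_add, show z + w + -z = w by ring]
  congr 2
  simp only [map_add, map_neg]
  ring

/-! ### Position, momentum, lowering and raising operators on Schwartz functions -/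

/-- The position operator, `(Q φ)(x) = x φ(x)`. -/
def Q : 𝓢(ℝ, ℂ) →ₗ[ℂ] 𝓢(ℝ, ℂ) :=
  (SchwartzMap.smulLeftCLM ℂ (fun x : ℝ => (x : ℂ))).toLinearMap

/-- The momentum operator, `P φ = - i φ'`. -/
def P : 𝓢(ℝ, ℂ) →ₗ[ℂ] 𝓢(ℝ, ℂ) :=
  (-Complex.I) • (SchwartzMap.derivCLM ℂ ℂ).toLinearMap

theorem Q_apply (φ : 𝓢(ℝ, ℂ)) (x : ℝ) : Q φ x = (x : ℂ) * φ x :=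
  SchwartzMap.smulLeftCLM_apply_apply (by fun_prop) φ x

theorem P_apply (φ : 𝓢(ℝ, ℂ)) (x : ℝ) : P φ x = -Complex.I * deriv φ x := rfl

/-- The lowering operator `a = (Q + i P) / √2`. -/
def lowering : 𝓢(ℝ, ℂ) →ₗ[ℂ] 𝓢(ℝ, ℂ) :=
  ((Real.sqrt 2 : ℂ)⁻¹) • (Q + Complex.I • P)

/-- The raising operator `a† = (Q - i P) / √2`. -/
def raising : 𝓢(ℝ, ℂ) →ₗ[ℂ] 𝓢(ℝ, ℂ) :=
  ((Real.sqrt 2 : ℂ)⁻¹) • (Q - Complex.I • P)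

/-- The inclusion of the Schwartz functions in `L²(ℝ)`. -/
def incl : 𝓢(ℝ, ℂ) →ₗ[ℂ] H :=
  (SchwartzMap.toLpCLM ℂ ℂ 2 (volume : Measure ℝ)).toLinearMap

theorem incl_injective : Function.Injective incl :=
  SchwartzMap.injective_toLp 2 (volume : Measure ℝ)

/-- A common dense domain for the quantum operators: a space of Schwartz functions, dense in
`L²(ℝ)` and invariant under `Q` and `P`. Examples: all Schwartz functions; the finite linear
combinations of the Hermite functions (number states). -/
structure FormDomain where
  space : Submodule ℂ 𝓢(ℝ, ℂ)
  dense : Dense (incl '' (space : Set 𝓢(ℝ, ℂ)))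
  Q_mem : ∀ φ ∈ space, Q φ ∈ space
  P_mem : ∀ φ ∈ space, P φ ∈ space

/-- The domain as a subspace of the Hilbert space. -/
def FormDomain.dom (𝒟 : FormDomain) : Submodule ℂ H := 𝒟.space.map incl

/-- An operator on Schwartz functions, as an unbounded operator on `L²(ℝ)` with domain `𝒟`. -/
def FormDomain.op (𝒟 : FormDomain) (T : 𝓢(ℝ, ℂ) →ₗ[ℂ] 𝓢(ℝ, ℂ)) : H →ₗ.[ℂ] H where
  domain := 𝒟.dom
  toFun := incl ∘ₗ T ∘ₗ 𝒟.space.subtype ∘ₗ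
    (Submodule.equivMapOfInjective incl incl_injective 𝒟.space).symm.toLinearMap

theorem FormDomain.op_apply (𝒟 : FormDomain) (T : 𝓢(ℝ, ℂ) →ₗ[ℂ] 𝓢(ℝ, ℂ)) (φ : 𝓢(ℝ, ℂ))
    (hφ : φ ∈ 𝒟.space) :
    𝒟.op T ⟨incl φ, Submodule.mem_map_of_mem hφ⟩ = incl (T φ) := by
  have : (Submodule.equivMapOfInjective incl incl_injective 𝒟.space).symm
      ⟨incl φ, Submodule.mem_map_of_mem hφ⟩ = ⟨φ, hφ⟩ := by
    rw [LinearEquiv.symm_apply_eq]; rfl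
  change incl (T ((Submodule.equivMapOfInjective incl incl_injective 𝒟.space).symm
      ⟨incl φ, Submodule.mem_map_of_mem hφ⟩ : 𝒟.space)) = _
  rw [this]

/-! ### Weights and the operators `M(z)` -/

/-- A weight on the form domain: `ϖ(0) = 1`, `ϖ` is continuous at `0` (so that the condition
at `0` is not void), and the integral `∫ ϖ(w) D(w) d²w / π` converges weakly on the domain. -/
structure Weight (𝒟 : FormDomain) where
  toFun : ℂ → ℂ
  at_zero : toFun 0 = 1
  continuousAt_zero : ContinuousAt toFun 0
  integrable : ∀ φ ∈ 𝒟.dom, ∀ ψ ∈ 𝒟.dom,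
    Integrable (fun w => toFun w * ⟪φ, D w ψ⟫_ℂ) ν

/-- A regular weight: even and real. -/
structure IsRegularWeight (ϖ : ℂ → ℂ) : Prop where
  even : ∀ z, ϖ (-z) = ϖ z
  real : ∀ z, conj (ϖ z) = ϖ z

/-- The sesquilinear form `⟨φ, M ψ⟩` of the operator `M = ∫ ϖ(w) D(w) d²w / π`. -/
def formM (ϖ : ℂ → ℂ) (φ ψ : H) : ℂ := ∫ w, ϖ w * ⟪φ, D w ψ⟫_ℂ ∂ν

/-- The sesquilinear form `⟨φ, M(z) ψ⟩` of the displaced operator `M(z) = D(z) M D(z)†`.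
The operator `M` need not be bounded. -/
def formMz (ϖ : ℂ → ℂ) (z : ℂ) (φ ψ : H) : ℂ := formM ϖ (Dadj z φ) (Dadj z ψ)

/-- If a bounded operator `M` has the form `formM`, then the bounded operator `D(z) M D(z)†`
has the form `formMz`. -/
theorem inner_conj_D (ϖ : ℂ → ℂ) (M : H →L[ℂ] H) (z : ℂ) (φ ψ : H)
    (hM : ⟪Dadj z φ, M (Dadj z ψ)⟫_ℂ = formM ϖ (Dadj z φ) (Dadj z ψ)) :
    ⟪φ, (D z ∘L M ∘L Dadj z) ψ⟫_ℂ = formMz ϖ z φ ψ := by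
  rw [formMz, ← hM, Dadj, ContinuousLinearMap.adjoint_inner_left]; rfl

variable {𝒟 : FormDomain}

theorem Weight.integrable_displaced (ϖ : Weight 𝒟) (z : ℂ) {φ ψ : H} (hφ : φ ∈ 𝒟.dom)
    (hψ : ψ ∈ 𝒟.dom) :
    Integrable (fun w => ϖ.toFun w * ⟪Dadj z φ, D w (Dadj z ψ)⟫_ℂ) ν := by
  have h := ϖ.integrable φ hφ ψ hψ
  have hc : Continuous fun w : ℂ => Complex.exp (z * conj w - conj z * w) := by fun_prop
  refine (h.bdd_mul (c := 1) hc.aestronglyMeasurable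
    (Eventually.of_forall fun w => ?_)).congr (Eventually.of_forall fun w => ?_)
  · rw [Complex.norm_exp]
    have : (z * conj w - conj z * w).re = 0 := by simp
    rw [this, Real.exp_zero]
  · simp only [inner_displaced]; ring

theorem formMz_add (ϖ : Weight 𝒟) (z : ℂ) {φ ψ₁ ψ₂ : H} (hφ : φ ∈ 𝒟.dom)
    (h₁ : ψ₁ ∈ 𝒟.dom) (h₂ : ψ₂ ∈ 𝒟.dom) :
    formMz ϖ.toFun z φ (ψ₁ + ψ₂) = formMz ϖ.toFun z φ ψ₁ + formMz ϖ.toFun z φ ψ₂ := by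
  simp only [formMz, formM]
  rw [← integral_add (ϖ.integrable_displaced z hφ h₁) (ϖ.integrable_displaced z hφ h₂)]
  simp only [map_add, inner_add_right, mul_add]

theorem formMz_smul (ϖ : ℂ → ℂ) (z c : ℂ) (φ ψ : H) :
    formMz ϖ z φ (c • ψ) = c * formMz ϖ z φ ψ := by
  simp only [formMz, formM]
  rw [← integral_const_mul]
  simp only [map_smul, inner_smul_right]
  congr 1; ext w; ring

/-! ### The quantization map -/

/-- `B_f(φ, ψ) = c`, where `B_f(φ, ψ) = ∫ ⟨φ, M(z) ψ⟩ f(z) d²z / π` is the sesquilinear form of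
the quantum operator `A_f`. The integral is taken with a Gaussian convergence factor, as
`lim_{ε → 0+} ∫ e^{-ε |z|²} ⟨φ, M(z) ψ⟩ f(z) d²z / π`; this is the Lebesgue integral whenever the
latter converges (see `HasForm.of_integrable`). -/
structure HasForm (ϖ f : ℂ → ℂ) (φ ψ : H) (c : ℂ) : Prop where
  integrable : ∀ ε : ℝ, 0 < ε →
    Integrable (fun z => (Real.exp (-ε * ‖z‖ ^ 2) : ℂ) * (formMz ϖ z φ ψ * f z)) ν
  tendsto : Tendsto
    (fun ε : ℝ => ∫ z, (Real.exp (-ε * ‖z‖ ^ 2) : ℂ) * (formMz ϖ z φ ψ * f z) ∂ν) (𝓝[>] 0) (𝓝 c)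

/-- The regularized integral agrees with the Lebesgue integral when the latter converges. -/
theorem HasForm.of_integrable {ϖ f : ℂ → ℂ} {φ ψ : H}
    (h : Integrable (fun z => formMz ϖ z φ ψ * f z) ν) :
    HasForm ϖ f φ ψ (∫ z, formMz ϖ z φ ψ * f z ∂ν) := by
  have hm : ∀ ε : ℝ, AEStronglyMeasurable (fun z : ℂ => (Real.exp (-ε * ‖z‖ ^ 2) : ℂ)) ν :=
    fun ε => Continuous.aestronglyMeasurable (by fun_prop)
  have hb : ∀ ε : ℝ, 0 < ε → ∀ z : ℂ, ‖(Real.exp (-ε * ‖z‖ ^ 2) : ℂ)‖ ≤ 1 := fun ε hε z => by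
    rw [Complex.norm_real, Real.norm_eq_abs, Real.abs_exp, Real.exp_le_one_iff]
    have := mul_nonneg hε.le (sq_nonneg ‖z‖)
    linarith
  refine ⟨fun ε hε => h.bdd_mul (c := 1) (hm ε) (Eventually.of_forall (hb ε hε)), ?_⟩
  refine tendsto_integral_filter_of_dominated_convergence (fun z => ‖formMz ϖ z φ ψ * f z‖)
    (Eventually.of_forall fun ε => (hm ε).mul h.1) ?_ h.norm (Eventually.of_forall fun z => ?_)
  · filter_upwards [self_mem_nhdsWithin] with ε hε
    refine Eventually.of_forall fun z => ?_
    rw [norm_mul]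
    exact mul_le_of_le_one_left (norm_nonneg _) (hb ε hε z)
  · have hc : Continuous fun ε : ℝ => (Real.exp (-ε * ‖z‖ ^ 2) : ℂ) * (formMz ϖ z φ ψ * f z) := by
      fun_prop
    simpa using (hc.tendsto 0).mono_left nhdsWithin_le_nhds

theorem HasForm.unique {ϖ f : ℂ → ℂ} {φ ψ : H} {c d : ℂ} (hc : HasForm ϖ f φ ψ c)
    (hd : HasForm ϖ f φ ψ d) : c = d :=
  tendsto_nhds_unique hc.tendsto hd.tendsto

theorem HasForm.add (ϖ : Weight 𝒟) {f : ℂ → ℂ} {φ ψ₁ ψ₂ : H} {c₁ c₂ : ℂ} (hφ : φ ∈ 𝒟.dom)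
    (h₁ : ψ₁ ∈ 𝒟.dom) (h₂ : ψ₂ ∈ 𝒟.dom) (H₁ : HasForm ϖ.toFun f φ ψ₁ c₁)
    (H₂ : HasForm ϖ.toFun f φ ψ₂ c₂) : HasForm ϖ.toFun f φ (ψ₁ + ψ₂) (c₁ + c₂) := by
  have e : ∀ (ε : ℝ) (z : ℂ),
      (Real.exp (-ε * ‖z‖ ^ 2) : ℂ) * (formMz ϖ.toFun z φ (ψ₁ + ψ₂) * f z)
        = (Real.exp (-ε * ‖z‖ ^ 2) : ℂ) * (formMz ϖ.toFun z φ ψ₁ * f z)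
          + (Real.exp (-ε * ‖z‖ ^ 2) : ℂ) * (formMz ϖ.toFun z φ ψ₂ * f z) := fun ε z => by
    rw [formMz_add ϖ z hφ h₁ h₂]; ring
  refine ⟨fun ε hε => ?_, ?_⟩
  · simp only [e]
    exact (H₁.integrable ε hε).add (H₂.integrable ε hε)
  · refine (H₁.tendsto.add H₂.tendsto).congr' ?_
    filter_upwards [self_mem_nhdsWithin] with ε hε
    simp only [e]
    rw [integral_add (H₁.integrable ε hε) (H₂.integrable ε hε)]

theorem HasForm.smul {ϖ f : ℂ → ℂ} {φ ψ : H} {c : ℂ} (k : ℂ) (h : HasForm ϖ f φ ψ c) :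
    HasForm ϖ f φ (k • ψ) (k * c) := by
  have e : ∀ (ε : ℝ) (z : ℂ),
      (Real.exp (-ε * ‖z‖ ^ 2) : ℂ) * (formMz ϖ z φ (k • ψ) * f z)
        = k * ((Real.exp (-ε * ‖z‖ ^ 2) : ℂ) * (formMz ϖ z φ ψ * f z)) := fun ε z => by
    rw [formMz_smul]; ring
  refine ⟨fun ε hε => ?_, ?_⟩
  · simp only [e]
    exact (h.integrable ε hε).const_mul k
  · simp only [e, integral_const_mul]
    exact h.tendsto.const_mul k

/-- The graph of `A_f`: the pairs `(ψ, χ)` with `ψ` in the form domain and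
`B_f(φ, ψ) = ⟨φ, χ⟩` for all `φ` in the form domain. -/
def quantGraph (ϖ : Weight 𝒟) (f : ℂ → ℂ) : Submodule ℂ (H × H) where
  carrier := {x | x.1 ∈ 𝒟.dom ∧ ∀ φ ∈ 𝒟.dom, HasForm ϖ.toFun f φ x.1 ⟪φ, x.2⟫_ℂ}
  zero_mem' := ⟨𝒟.dom.zero_mem, fun φ _ => by
    have h : HasForm ϖ.toFun f φ (0 : H) 0 := by
      constructor <;> simp [formMz, formM]
    simpa using h⟩
  add_mem' := fun {x y} hx hy => ⟨𝒟.dom.add_mem hx.1 hy.1, fun φ hφ => by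
    rw [Prod.snd_add, inner_add_right]
    exact HasForm.add ϖ hφ hx.1 hy.1 (hx.2 φ hφ) (hy.2 φ hφ)⟩
  smul_mem' := fun k x hx => ⟨𝒟.dom.smul_mem k hx.1, fun φ hφ => by
    rw [Prod.smul_snd, inner_smul_right]
    exact HasForm.smul k (hx.2 φ hφ)⟩

theorem quantGraph_functional (ϖ : Weight 𝒟) (f : ℂ → ℂ) (x : H × H)
    (hx : x ∈ quantGraph ϖ f) (h0 : x.1 = 0) : x.2 = 0 := by
  have hd : Dense (𝒟.dom : Set H) := by
    simpa [FormDomain.dom, Submodule.map_coe] using 𝒟.dense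
  refine hd.eq_zero_of_inner_right ℂ fun φ hφ => ?_
  have h1 := hx.2 φ hφ
  rw [h0] at h1
  exact h1.unique (((quantGraph ϖ f).zero_mem).2 φ hφ) |>.trans (inner_zero_right φ)

/-- The quantum operator `A_f = ∫ M(z) f(z) d²z / π`, in the weak sense on the form domain: its
domain consists of the `ψ` in the form domain for which some `χ` satisfies
`B_f(φ, ψ) = ⟨φ, χ⟩` for all `φ` in the form domain, and `A_f ψ = χ`. -/
def A (ϖ : Weight 𝒟) (f : ℂ → ℂ) : H →ₗ.[ℂ] H := (quantGraph ϖ f).toLinearPMap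

theorem A_graph (ϖ : Weight 𝒟) (f : ℂ → ℂ) : (A ϖ f).graph = quantGraph ϖ f :=
  Submodule.toLinearPMap_graph_eq _ fun x hx h0 => quantGraph_functional ϖ f x hx h0

/-- `[S, T] = c I` on the domain `V`: for every `ψ ∈ V` the vectors `S T ψ` and `T S ψ` are
defined, and `S T ψ - T S ψ = c ψ`. -/
def CommutatorEq (S T : H →ₗ.[ℂ] H) (V : Submodule ℂ H) (c : ℂ) : Prop :=
  ∀ ψ ∈ V, ∃ (hS : ψ ∈ S.domain) (hT : ψ ∈ T.domain) (hTS : S ⟨ψ, hS⟩ ∈ T.domain)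
    (hST : T ⟨ψ, hT⟩ ∈ S.domain), S ⟨_, hST⟩ - T ⟨_, hTS⟩ = c • ψ

end

end WHQuant

namespace WHQuant

noncomputable section

/-! ### Gaussian integrals on the phase space -/

/-! Put h(w) = ⟨φ, D(w)ψ⟩ and g = ϖ h. Since D(z)D(w)D(z)† = e^{z w̄ - z̄ w} D(w), the function z ↦
⟨φ, M(z)ψ⟩ is the symplectic Fourier transform of g, and integrating it against z should return a
derivative of g at the origin. With the Gaussian factor this is rigorous: Fubini
(`integrable_kernel`) and an explicit integral (`integral_gaussian_symplectic_mul`) turn the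
regularized form of A_z into -∫ g K_ε dν with K_ε(w) = w ε⁻² e^{-|w|²/ε}. This kernel annihilates w,
has integral 1 against w̄ and concentrates at 0, so it extracts the w̄-coefficient of the derivative
(`tendsto_gaussian_first_moment`). For h the derivative at 0 is w⟨φ, a†ψ⟩ - w̄⟨φ, aψ⟩
(`hasFDerivAt_inner_D`), whence A_z = a.

The weight is only continuous at 0, so g itself need not be differentiable there. But K_ε is odd and
ϖ is even, so only ϖ times the odd part of h matters; that odd part vanishes at 0, and continuity
with ϖ(0) = 1 then suffices (`hasFDerivAt_mul_of_continuousAt`).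

Reality and evenness of ϖ together with D(w)† = D(-w) make the form of M Hermitian (`formM_conj`).
This gives all statements on A_{f̄}, in particular A_{z̄} = a† from A_z = a; position and momentum
follow by linearity in f. Density of the domain upgrades equalities of forms to equalities of
operators (`A_eq_op`), and the commutation rules reduce to QP - PQ = i on Schwartz functions.
Bounded weights are admissible because h decreases rapidly (`norm_pow_mul_inner_D_le`). -/

instance : SFinite ν := by unfold ν; infer_instance

theorem integrable_nu_iff {f : ℂ → ℂ} : Integrable f ν ↔ Integrable f volume := by
  unfold ν
  exact integrable_smul_measure (by simp [Real.pi_pos]) ENNReal.ofReal_ne_top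

theorem integral_nu (f : ℂ → ℂ) : ∫ z, f z ∂ν = (Real.pi : ℂ)⁻¹ * ∫ z, f z := by
  unfold ν
  rw [integral_smul_measure, ENNReal.toReal_ofReal (by positivity), Complex.real_smul]
  simp

theorem integral_norm_pow_mul_gaussian (k : ℕ) {b : ℝ} (hb : 0 < b) :
    ∫ z : ℂ, ‖z‖ ^ k * Real.exp (-b * ‖z‖ ^ 2)
      = Real.pi * b ^ (-((k : ℝ) + 2) / 2) * Real.Gamma (((k : ℝ) + 2) / 2) := by
  have h := Complex.integral_rpow_mul_exp_neg_mul_rpow (p := 2) (q := k) one_le_two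
    (by have : (0 : ℝ) ≤ k := k.cast_nonneg
        linarith) hb
  simp only [Real.rpow_natCast, Real.rpow_two] at h
  rw [h]; ring

theorem integrable_norm_pow_mul_gaussian (k : ℕ) {b : ℝ} (hb : 0 < b) :
    Integrable (fun z : ℂ => ‖z‖ ^ k * Real.exp (-b * ‖z‖ ^ 2)) := by
  -- The integral of a non-integrable function is 0 by convention, whereas the closed formula is
  -- positive.
  by_contra h
  have h1 := integral_norm_pow_mul_gaussian k hb
  rw [integral_undef h] at h1
  have h2 : 0 < Real.Gamma (((k : ℝ) + 2) / 2) := Real.Gamma_pos_of_pos (by positivity)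
  have : 0 < Real.pi * b ^ (-((k : ℝ) + 2) / 2) * Real.Gamma (((k : ℝ) + 2) / 2) := by
    have := Real.pi_pos
    positivity
  exact this.ne h1

theorem norm_symplectic (z w : ℂ) : ‖Complex.exp (z * conj w - conj z * w)‖ = 1 := by
  rw [Complex.norm_exp]
  have : (z * conj w - conj z * w).re = 0 := by simp
  rw [this, Real.exp_zero]

theorem symplectic_eq (z w : ℂ) :
    z * conj w - conj z * w = 2 * Complex.I * ((inner ℝ (Complex.I * w) z : ℝ) : ℂ) := by
  rw [Complex.inner]
  apply Complex.ext
  · simp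
  · simp; ring

theorem integrable_gaussian_symplectic {ε : ℝ} (hε : 0 < ε) (w : ℂ) :
    Integrable (fun z : ℂ => (Real.exp (-ε * ‖z‖ ^ 2) : ℂ) *
      Complex.exp (z * conj w - conj z * w)) := by
  refine (integrable_norm_pow_mul_gaussian 0 hε).mono'
    (Continuous.aestronglyMeasurable (by fun_prop)) (Eventually.of_forall fun z => ?_)
  rw [norm_mul, norm_symplectic, Complex.norm_real, Real.norm_eq_abs, Real.abs_exp]
  simp

theorem integrable_gaussian_symplectic_mul {ε : ℝ} (hε : 0 < ε) (w : ℂ) :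
    Integrable (fun z : ℂ => (Real.exp (-ε * ‖z‖ ^ 2) : ℂ) *
      Complex.exp (z * conj w - conj z * w) * z) := by
  refine (integrable_norm_pow_mul_gaussian 1 hε).mono'
    (Continuous.aestronglyMeasurable (by fun_prop)) (Eventually.of_forall fun z => ?_)
  rw [norm_mul, norm_mul, norm_symplectic, Complex.norm_real, Real.norm_eq_abs, Real.abs_exp]
  apply le_of_eq; ring

theorem integral_gaussian_symplectic {ε : ℝ} (hε : 0 < ε) (w : ℂ) :
    ∫ z : ℂ, (Real.exp (-ε * ‖z‖ ^ 2) : ℂ) * Complex.exp (z * conj w - conj z * w)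
      = (Real.pi / ε) * (Real.exp (-‖w‖ ^ 2 / ε) : ℂ) := by
  have h := GaussianFourier.integral_cexp_neg_mul_sq_norm_add (b := (ε : ℂ)) (V := ℂ)
    (by simpa using hε) (2 * Complex.I) (Complex.I * w)
  have e1 : (((Module.finrank ℝ ℂ : ℕ) : ℂ) / 2) = 1 := by simp
  rw [e1, Complex.cpow_one] at h
  have hε' : (ε : ℂ) ≠ 0 := by exact_mod_cast hε.ne'
  have e2 : (2 * Complex.I) ^ 2 * (‖Complex.I * w‖ : ℂ) ^ 2 / (4 * (ε : ℂ))
      = ((-‖w‖ ^ 2 / ε : ℝ) : ℂ) := by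
    rw [mul_pow, Complex.I_sq, norm_mul, Complex.norm_I, one_mul]
    push_cast
    field_simp
    ring
  rw [e2] at h
  rw [Complex.ofReal_exp, ← h]
  congr 1; ext z
  rw [Complex.ofReal_exp, ← Complex.exp_add, symplectic_eq]
  push_cast
  rfl

theorem integral_fderiv_apply_eq_zero {g : ℂ → ℂ} (v : ℂ) (hd : Differentiable ℝ g)
    (hg : Integrable g) (hg' : Integrable fun z => fderiv ℝ g z v) :
    ∫ z, fderiv ℝ g z v = 0 := by
  have h := integral_mul_fderiv_eq_neg_fderiv_mul_of_integrable (μ := (volume : Measure ℂ))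
    (f := fun _ : ℂ => (1 : ℂ)) (g := g) (v := v) (by simp) (by simpa using hg')
    (by simpa using hg) (fun _ _ => differentiableAt_const _) (fun x _ => hd x)
  simpa using h

theorem hasFDerivAt_gaussian_symplectic (ε : ℝ) (w z : ℂ) :
    HasFDerivAt (𝕜 := ℝ) (fun z : ℂ => (Real.exp (-ε * ‖z‖ ^ 2) : ℂ) *
        Complex.exp (z * conj w - conj z * w))
      (((Real.exp (-ε * ‖z‖ ^ 2) : ℂ) * Complex.exp (z * conj w - conj z * w)) •
        (-(ε : ℂ) • (z • (Complex.conjCLE : ℂ →L[ℝ] ℂ) + conj z • ContinuousLinearMap.id ℝ ℂ)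
          + (conj w • ContinuousLinearMap.id ℝ ℂ - w • (Complex.conjCLE : ℂ →L[ℝ] ℂ)))) z := by
  have e : (fun z : ℂ => (Real.exp (-ε * ‖z‖ ^ 2) : ℂ) *
      Complex.exp (z * conj w - conj z * w))
      = fun z : ℂ => Complex.exp (-(ε : ℂ) * (z * conj z) + (z * conj w - conj z * w)) := by
    ext z
    rw [Complex.ofReal_exp, ← Complex.exp_add, Complex.mul_conj, Complex.normSq_eq_norm_sq]
    push_cast; rfl
  have e' := congrFun e z
  rw [e', e]
  have h1 : HasFDerivAt (𝕜 := ℝ) (fun z : ℂ => z) (ContinuousLinearMap.id ℝ ℂ) z := hasFDerivAt_id z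
  have h2 : HasFDerivAt (𝕜 := ℝ) (fun z : ℂ => conj z) (Complex.conjCLE : ℂ →L[ℝ] ℂ) z :=
    Complex.conjCLE.hasFDerivAt
  have h3 := (((h1.mul h2).const_mul (-(ε : ℂ))).add
    ((h1.mul_const (conj w)).sub (h2.mul_const w))).cexp
  exact h3

/-- For g(z) = e^{-ε|z|² + z w̄ - z̄ w} one has ∂g/∂z̄ = -(ε z + w) g, and the integral of a
derivative vanishes. The first moment is therefore -w/ε times the total mass. -/
theorem integral_gaussian_symplectic_mul {ε : ℝ} (hε : 0 < ε) (w : ℂ) :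
    ∫ z : ℂ, (Real.exp (-ε * ‖z‖ ^ 2) : ℂ) * Complex.exp (z * conj w - conj z * w) * z ∂ν
      = -(w / ε ^ 2 * (Real.exp (-‖w‖ ^ 2 / ε) : ℂ)) := by
  set g : ℂ → ℂ := fun z => (Real.exp (-ε * ‖z‖ ^ 2) : ℂ) *
    Complex.exp (z * conj w - conj z * w) with hg
  have hgi : Integrable g := integrable_gaussian_symplectic hε w
  have hgz : Integrable fun z => g z * z := integrable_gaussian_symplectic_mul hε w
  have hgc : Integrable fun z => g z * conj z := by
    refine hgz.mono (Continuous.aestronglyMeasurable (by fun_prop))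
      (Eventually.of_forall fun z => ?_)
    simp
  have hd : ∀ z v, fderiv ℝ g z v
      = -ε * conj v * (g z * z) + -ε * v * (g z * conj z)
        + (v * conj w - conj v * w) * g z := fun z v => by
    rw [(hasFDerivAt_gaussian_symplectic ε w z).fderiv]
    simp only [_root_.smul_apply, _root_.add_apply,
      _root_.sub_apply, smul_eq_mul, ContinuousLinearEquiv.coe_coe,
      Complex.conjCLE_apply, ContinuousLinearMap.id_apply, hg]
    ring
  have hab : ∀ v : ℂ, Integrable fun z => -ε * conj v * (g z * z) + -ε * v * (g z * conj z) :=
    fun v => (hgz.const_mul _).add (hgc.const_mul _)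
  have key : ∀ v : ℂ, -ε * conj v * (∫ z, g z * z) + -ε * v * (∫ z, g z * conj z)
      + (v * conj w - conj v * w) * ∫ z, g z = 0 := fun v => by
    have hi : Integrable fun z => fderiv ℝ g z v := by
      simp only [hd]
      exact (hab v).add (hgi.const_mul _)
    have h0 := integral_fderiv_apply_eq_zero (g := g) v
      (fun z => (hasFDerivAt_gaussian_symplectic ε w z).differentiableAt) hgi hi
    simp only [hd] at h0
    rwa [integral_add (hab v) (hgi.const_mul _),
      integral_add (hgz.const_mul _) (hgc.const_mul _), integral_const_mul, integral_const_mul,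
      integral_const_mul] at h0
  have h1 := key 1
  have h2 := key Complex.I
  have hI : ∫ z, g z = (Real.pi / ε) * (Real.exp (-‖w‖ ^ 2 / ε) : ℂ) :=
    integral_gaussian_symplectic hε w
  have hε' : (ε : ℂ) ≠ 0 := by exact_mod_cast hε.ne'
  have hπ : (Real.pi : ℂ) ≠ 0 := by exact_mod_cast Real.pi_ne_zero
  -- `key 1` plus i times `key I` is the equation for 2 ∂/∂z̄ = ∂_x + i ∂_y; the moment against z̄
  -- cancels.
  have h3 : ε * (∫ z, g z * z) = -w * ∫ z, g z := by
    simp only [map_one, Complex.conj_I] at h1 h2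
    linear_combination (-1 / 2) * h1 - (Complex.I / 2) * h2 +
      (1 / 2) * (ε * (∫ z, g z * z) - ε * (∫ z, g z * conj z) + (conj w + w) * ∫ z, g z)
        * Complex.I_sq
  have h4 : (∫ z, g z * z) = -w * (∫ z, g z) / ε := by
    rw [eq_div_iff hε', ← h3]; ring
  rw [integral_nu]
  change _ * (∫ z, g z * z) = _
  rw [h4, hI]
  field_simp

/-- The first moment of an integrable function, differentiable and zero at the origin, against
a shrinking Gaussian: only the antiholomorphic part of the derivative contributes. -/
theorem tendsto_gaussian_first_moment {k : ℂ → ℂ} {L : ℂ →L[ℝ] ℂ} {α β : ℂ}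
    (hk : Integrable k ν) (h0 : k 0 = 0) (hd : HasFDerivAt k L 0)
    (hL : ∀ w, L w = α * w + β * conj w) :
    Tendsto (fun ε : ℝ => ∫ w, k w * (w / ε ^ 2 * (Real.exp (-‖w‖ ^ 2 / ε) : ℂ)) ∂ν)
      (𝓝[>] 0) (𝓝 β) := by
  rw [integrable_nu_iff] at hk
  -- The term α w would contribute α w²/|w|² to `G`, which has no limit at 0, so it is removed
  -- first. The Gaussian factor keeps the correction integrable. What remains behaves like β w̄, so
  -- `G` is continuous at 0 with value β.
  set κ : ℂ → ℂ := fun w => k w - α * w * (Real.exp (-1 * ‖w‖ ^ 2) : ℂ) with hκ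
  set G : ℂ → ℂ := fun w => if w = 0 then β else κ w * (w / (‖w‖ : ℂ) ^ 2) with hG
  have hG0 : G 0 = β := by simp [hG]
  have hlin : Integrable fun w : ℂ => α * w * (Real.exp (-1 * ‖w‖ ^ 2) : ℂ) := by
    refine ((integrable_norm_pow_mul_gaussian 1 one_pos).const_mul ‖α‖).mono'
      (Continuous.aestronglyMeasurable (by fun_prop)) (Eventually.of_forall fun z => ?_)
    rw [norm_mul, norm_mul, Complex.norm_real, Real.norm_eq_abs, Real.abs_exp]
    apply le_of_eq; ring
  have hκi : Integrable κ := hk.sub hlin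
  have hwn : ∀ w : ℂ, ‖w / (‖w‖ : ℂ) ^ 2‖ = ‖w‖⁻¹ := fun w => by
    rw [norm_div, norm_pow, Complex.norm_real, norm_norm]
    rcases eq_or_ne w 0 with rfl | hw
    · simp
    · have := norm_ne_zero_iff.2 hw
      field_simp
  have hcont : ContinuousAt G 0 := by
    rw [ContinuousAt, hG0, tendsto_iff_norm_sub_tendsto_zero]
    have hlim : Tendsto (fun w : ℂ => ‖w‖⁻¹ * ‖k w - L w‖ +
        ‖α‖ * |1 - Real.exp (-1 * ‖w‖ ^ 2)|) (𝓝 0) (𝓝 0) := by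
      have t1 : Tendsto (fun w : ℂ => ‖w‖⁻¹ * ‖k w - L w‖) (𝓝 0) (𝓝 0) := by
        have := hasFDerivAt_iff_tendsto.1 hd
        simpa [h0] using this
      have t2 : Tendsto (fun w : ℂ => ‖α‖ * |1 - Real.exp (-1 * ‖w‖ ^ 2)|) (𝓝 0) (𝓝 0) := by
        have hc : Continuous fun w : ℂ => ‖α‖ * |1 - Real.exp (-1 * ‖w‖ ^ 2)| := by fun_prop
        simpa using hc.tendsto 0
      simpa using t1.add t2
    refine squeeze_zero (fun _ => norm_nonneg _) (fun w => ?_) hlim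
    rcases eq_or_ne w 0 with rfl | hw
    · simp [hG]
    · have hwn0 := norm_ne_zero_iff.2 hw
      have e : G w - β = (k w - L w) * (w / (‖w‖ : ℂ) ^ 2) +
          α * (w * (w / (‖w‖ : ℂ) ^ 2)) * ((1 - Real.exp (-1 * ‖w‖ ^ 2) : ℝ) : ℂ) := by
        simp only [hG, if_neg hw, hκ, hL]
        have hb : β = β * conj w * (w / (‖w‖ : ℂ) ^ 2) := by
          have : conj w * w = (‖w‖ : ℂ) ^ 2 := Complex.conj_mul' w
          rw [mul_assoc, ← mul_div_assoc, this, div_self, mul_one]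
          exact pow_ne_zero _ (by exact_mod_cast hwn0)
        push_cast
        linear_combination -hb
      rw [e]
      refine (norm_add_le _ _).trans (le_of_eq ?_)
      rw [norm_mul, norm_mul, norm_mul, norm_mul, hwn, Complex.norm_real, Real.norm_eq_abs,
        mul_inv_cancel₀ hwn0]
      ring
  have hGi : Integrable G := by
    -- Near 0, `G` is bounded by continuity; outside the δ-ball, |G| = |κ|/|w| ≤ |κ|/δ.
    obtain ⟨δ, hδ, hball⟩ := Metric.eventually_nhds_iff_ball.1
      (hcont.norm.eventually_lt_const (lt_add_one ‖G 0‖))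
    have hm : AEStronglyMeasurable G := by
      have h1 : AEStronglyMeasurable (fun w => κ w * (w / (‖w‖ : ℂ) ^ 2)) :=
        hκi.1.mul (Measurable.aestronglyMeasurable (by fun_prop))
      refine h1.congr ?_
      filter_upwards [Measure.ae_ne (volume : Measure ℂ) 0] with w hw
      simp [hG, hw]
    have hind : Integrable ((Metric.ball (0 : ℂ) δ).indicator fun _ => ‖G 0‖ + 1) :=
      (integrable_indicator_iff measurableSet_ball).2
        (integrableOn_const measure_ball_lt_top.ne)
    refine (hind.add (hκi.norm.mul_const δ⁻¹)).mono' hm (Eventually.of_forall fun w => ?_)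
    simp only [Pi.add_apply]
    by_cases hw : w ∈ Metric.ball (0 : ℂ) δ
    · rw [Set.indicator_of_mem hw]
      have := hball w hw
      have : 0 ≤ ‖κ w‖ * δ⁻¹ := by positivity
      linarith
    · rw [Set.indicator_of_notMem hw, zero_add]
      have hw' : δ ≤ ‖w‖ := by simpa using hw
      have hw0 : w ≠ 0 := norm_ne_zero_iff.1 (hδ.trans_le hw').ne'
      simp only [hG, if_neg hw0]
      rw [norm_mul, hwn]
      gcongr
  -- The kernel π⁻¹|u|² e^{-|u|²} is a probability density since Γ(2) = 1. Rescaled by c = ε^{-1/2}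
  -- in real dimension 2, it becomes π⁻¹ ε⁻² |w|² e^{-|w|²/ε}, whose product with `G` is π⁻¹ κ K_ε
  -- away from 0.
  have hpeak := tendsto_integral_comp_smul_smul_of_integrable (μ := (volume : Measure ℂ))
    (φ := fun u : ℂ => Real.pi⁻¹ * (‖u‖ ^ 2 * Real.exp (-1 * ‖u‖ ^ 2)))
    (fun u => by have := Real.pi_pos; positivity)
    (by rw [integral_const_mul, integral_norm_pow_mul_gaussian 2 one_pos]
        have : ((2 : ℕ) + 2 : ℝ) / 2 = 2 := by norm_num
        rw [this, Real.Gamma_two, Real.one_rpow]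
        field_simp)
    (by
      rw [Complex.finrank_real_complex]
      have h1 : Tendsto (fun t : ℝ => Real.pi⁻¹ * (t ^ 2 * Real.exp (-t))) atTop (𝓝 0) := by
        simpa using (Real.tendsto_pow_mul_exp_neg_atTop_nhds_zero 2).const_mul Real.pi⁻¹
      have h2 : Tendsto (fun u : ℂ => ‖u‖ ^ 2) (Bornology.cobounded ℂ) atTop :=
        (tendsto_pow_atTop two_ne_zero).comp tendsto_norm_cobounded_atTop
      refine (h1.comp h2).congr fun u => ?_
      simp only [Function.comp]
      rw [neg_one_mul]
      ring)
    hGi hcont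
  rw [hG0] at hpeak
  have hc : Tendsto (fun ε : ℝ => (Real.sqrt ε)⁻¹) (𝓝[>] 0) atTop := by
    refine tendsto_inv_nhdsGT_zero.comp (tendsto_nhdsWithin_iff.2 ⟨?_, ?_⟩)
    · have := Real.continuous_sqrt.tendsto 0
      rw [Real.sqrt_zero] at this
      exact this.mono_left nhdsWithin_le_nhds
    · filter_upwards [self_mem_nhdsWithin] with ε hε
      exact Real.sqrt_pos.2 hε
  refine (hpeak.comp hc).congr' ?_
  filter_upwards [self_mem_nhdsWithin] with ε hε
  have hε : 0 < ε := hε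
  have hε' : (ε : ℂ) ≠ 0 := by exact_mod_cast hε.ne'
  set K : ℂ → ℂ := fun w => w / ε ^ 2 * (Real.exp (-‖w‖ ^ 2 / ε) : ℂ) with hK
  -- A crude bound for fixed ε, needed only for integrability: (1 + ε)e^t ≥ (1 + ε)(1 + t) ≥ 1 +
  -- |w|² ≥ |w| with t = |w|²/ε.
  have hKb : ∃ C, ∀ w, ‖K w‖ ≤ C := by
    refine ⟨(1 + ε) / ε ^ 2, fun w => ?_⟩
    rw [hK, norm_mul, norm_div, norm_pow, Complex.norm_real, Complex.norm_real, Real.norm_eq_abs,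
      Real.norm_eq_abs, Real.abs_exp, abs_of_pos hε, div_mul_eq_mul_div]
    gcongr
    rw [neg_div, Real.exp_neg, ← div_eq_mul_inv, div_le_iff₀ (Real.exp_pos _)]
    have h1 := Real.add_one_le_exp (‖w‖ ^ 2 / ε)
    have h2 : (1 + ε) * (‖w‖ ^ 2 / ε + 1) ≤ (1 + ε) * Real.exp (‖w‖ ^ 2 / ε) := by gcongr
    have h3 : (1 + ε) * (‖w‖ ^ 2 / ε + 1) = ‖w‖ ^ 2 / ε + ‖w‖ ^ 2 + (1 + ε) := by
      field_simp
    have h4 : 0 ≤ ‖w‖ ^ 2 / ε := by positivity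
    nlinarith [sq_nonneg (‖w‖ - 1)]
  obtain ⟨C, hC⟩ := hKb
  have hKm : AEStronglyMeasurable K := Continuous.aestronglyMeasurable (by fun_prop)
  have hi1 : Integrable fun w => k w * K w := hk.mul_bdd hKm (Eventually.of_forall hC)
  have hi2 : Integrable fun w => α * w * (Real.exp (-1 * ‖w‖ ^ 2) : ℂ) * K w :=
    hlin.mul_bdd hKm (Eventually.of_forall hC)
  -- The integrand is w² times a radial function, so the measure-preserving rotation w ↦ i w changes
  -- its sign.
  have hzero : ∫ w, α * w * (Real.exp (-1 * ‖w‖ ^ 2) : ℂ) * K w = 0 := by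
    have hI : ‖Complex.I‖ = 1 := Complex.norm_I
    have hrot := (LinearIsometryEquiv.measurePreserving
      (rotation ⟨Complex.I, mem_sphere_zero_iff_norm.2 hI⟩)).integral_comp
      (rotation ⟨Complex.I, mem_sphere_zero_iff_norm.2 hI⟩).toHomeomorph.measurableEmbedding
      (fun w => α * w * (Real.exp (-1 * ‖w‖ ^ 2) : ℂ) * K w)
    have e : ∀ w, α * (Complex.I * w) * (Real.exp (-1 * ‖Complex.I * w‖ ^ 2) : ℂ)
        * K (Complex.I * w) = -(α * w * (Real.exp (-1 * ‖w‖ ^ 2) : ℂ) * K w) := fun w => by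
      simp only [hK, norm_mul, hI, one_mul]
      linear_combination (α * w * (Real.exp (-1 * ‖w‖ ^ 2) : ℂ) *
        (w / ε ^ 2 * (Real.exp (-‖w‖ ^ 2 / ε) : ℂ))) * Complex.I_sq
    have hrot' : ∫ w, -(α * w * (Real.exp (-1 * ‖w‖ ^ 2) : ℂ) * K w)
        = ∫ w, α * w * (Real.exp (-1 * ‖w‖ ^ 2) : ℂ) * K w :=
      (integral_congr_ae (Eventually.of_forall fun w => (e w).symm)).trans hrot
    rw [integral_neg] at hrot'
    linear_combination (-1 / 2) * hrot'
  rw [integral_nu]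
  simp only [Function.comp]
  have e1 : ∫ w, k w * K w = ∫ w, κ w * K w := by
    have : ∀ w, κ w * K w = k w * K w - α * w * (Real.exp (-1 * ‖w‖ ^ 2) : ℂ) * K w := fun w => by
      simp only [hκ]; ring
    simp only [this]
    rw [integral_sub hi1 hi2, hzero, sub_zero]
  change _ = _ * ∫ w, k w * K w
  rw [e1, ← integral_const_mul]
  congr 1; ext w
  rw [Complex.finrank_real_complex, norm_smul, Real.norm_eq_abs, abs_inv,
    abs_of_nonneg (Real.sqrt_nonneg ε), mul_pow, inv_pow, Real.sq_sqrt hε.le]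
  rcases eq_or_ne w 0 with rfl | hw
  · simp [hK]
  · have hwn0 : (‖w‖ : ℂ) ≠ 0 := by exact_mod_cast norm_ne_zero_iff.2 hw
    have hπ : (Real.pi : ℂ) ≠ 0 := by exact_mod_cast Real.pi_ne_zero
    have e2 : -1 * (ε⁻¹ * ‖w‖ ^ 2) = -‖w‖ ^ 2 / ε := by ring
    simp only [hG, if_neg hw, hK, Complex.real_smul, e2]
    push_cast
    field_simp

/-! ### Matrix elements of the displacement operators between Schwartz functions -/

theorem coeFn_incl (φ : 𝓢(ℝ, ℂ)) : incl φ =ᵐ[volume] φ :=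
  SchwartzMap.coeFn_toLp φ 2 volume

theorem inner_incl (φ ψ : 𝓢(ℝ, ℂ)) : ⟪incl φ, incl ψ⟫_ℂ = ∫ x, conj (φ x) * ψ x := by
  rw [L2.inner_def]
  refine integral_congr_ae ?_
  filter_upwards [coeFn_incl φ, coeFn_incl ψ] with x h1 h2
  rw [h1, h2, RCLike.inner_apply, mul_comm]

theorem inner_incl_D (w : ℂ) (φ ψ : 𝓢(ℝ, ℂ)) :
    ⟪incl φ, D w (incl ψ)⟫_ℂ = ∫ x, conj (φ x) * dispFun w ψ x := by
  rw [L2.inner_def]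
  refine integral_congr_ae ?_
  filter_upwards [coeFn_incl φ, coeFn_D w (incl ψ),
    ae_shift (Real.sqrt 2 * w.re) (coeFn_incl ψ)] with x h1 h2 h3
  rw [h1, h2, RCLike.inner_apply, mul_comm, dispFun, h3, dispFun]

theorem exists_bound (ψ : 𝓢(ℝ, ℂ)) : ∃ C, 0 ≤ C ∧ ∀ x, ‖ψ x‖ ≤ C := by
  obtain ⟨C, hC⟩ := ψ.decay 0 0
  exact ⟨C, hC.1.le, fun x => by simpa using hC.2 x⟩

theorem hasDerivAt_schwartz (ψ : 𝓢(ℝ, ℂ)) (x : ℝ) : HasDerivAt ψ (Complex.I * P ψ x) x := by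
  have h : Complex.I * P ψ x = deriv ψ x := by
    rw [P_apply]
    linear_combination (-deriv ψ x) * Complex.I_sq
  rw [h]
  exact ψ.differentiableAt.hasDerivAt

theorem continuous_dispFun (w : ℂ) (ψ : 𝓢(ℝ, ℂ)) : Continuous (dispFun w ψ) := by
  have := ψ.continuous
  unfold dispFun
  fun_prop

theorem continuous_dispFun_left (ψ : 𝓢(ℝ, ℂ)) (x : ℝ) : Continuous fun w => dispFun w ψ x := by
  have := ψ.continuous
  unfold dispFun
  fun_prop

theorem integrable_conj_mul_dispFun (w : ℂ) (φ ψ : 𝓢(ℝ, ℂ)) :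
    Integrable fun x => conj (φ x) * dispFun w ψ x := by
  obtain ⟨C, _, hC⟩ := exists_bound ψ
  have := φ.continuous
  have := continuous_dispFun w ψ
  refine (φ.integrable.norm.mul_const C).mono' (Continuous.aestronglyMeasurable (by fun_prop))
    (Eventually.of_forall fun x => ?_)
  rw [norm_mul, norm_dispFun, RCLike.norm_conj]
  gcongr
  exact hC _

theorem continuous_inner_D (φ ψ : 𝓢(ℝ, ℂ)) :
    Continuous fun w => ⟪incl φ, D w (incl ψ)⟫_ℂ := by
  simp only [inner_incl_D]
  obtain ⟨C, _, hC⟩ := exists_bound ψ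
  refine continuous_of_dominated (bound := fun x => ‖φ x‖ * C)
    (fun w => (integrable_conj_mul_dispFun w φ ψ).1) (fun w => Eventually.of_forall fun x => ?_)
    (φ.integrable.norm.mul_const C) (Eventually.of_forall fun x => ?_)
  · rw [norm_mul, norm_dispFun, RCLike.norm_conj]
    gcongr
    exact hC _
  · exact (continuous_dispFun_left ψ x).const_mul _

/-- D(w) translates by q = √2 Re w, and q = x - (x - q). -/
theorem re_mul_inner_D (w : ℂ) (φ ψ : 𝓢(ℝ, ℂ)) :
    ((Real.sqrt 2 * w.re : ℝ) : ℂ) * ⟪incl φ, D w (incl ψ)⟫_ℂ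
      = ⟪incl (Q φ), D w (incl ψ)⟫_ℂ - ⟪incl φ, D w (incl (Q ψ))⟫_ℂ := by
  simp only [inner_incl_D]
  rw [← integral_sub (integrable_conj_mul_dispFun _ _ _) (integrable_conj_mul_dispFun _ _ _),
    ← integral_const_mul]
  congr 1; ext x
  simp only [dispFun, Q_apply, map_mul, Complex.conj_ofReal]
  push_cast
  ring

theorem hasDerivAt_dispFun (w : ℂ) (ψ : 𝓢(ℝ, ℂ)) (x : ℝ) :
    HasDerivAt (dispFun w ψ) (Complex.I * (((Real.sqrt 2 * w.im : ℝ) : ℂ) * dispFun w ψ x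
      + dispFun w (P ψ) x)) x := by
  have h1 : HasDerivAt (fun x : ℝ => Complex.I *
      ((Real.sqrt 2 * w.im * (x - Real.sqrt 2 * w.re / 2) : ℝ) : ℂ))
      (Complex.I * ((Real.sqrt 2 * w.im * 1 : ℝ) : ℂ)) x :=
    ((((hasDerivAt_id x).sub_const _).const_mul _).ofReal_comp).const_mul _
  have h2 : HasDerivAt (fun x : ℝ => ψ (x - Real.sqrt 2 * w.re))
      (Complex.I * P ψ (x - Real.sqrt 2 * w.re)) x :=
    (hasDerivAt_schwartz ψ _).comp_sub_const x _
  refine (h1.cexp.mul h2).congr_deriv ?_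
  simp only [dispFun, mul_one]
  ring

/-- The momentum counterpart: differentiating the phase of D(w)ψ produces p = √2 Im w, and
integration by parts moves the derivative onto φ. -/
theorem im_mul_inner_D (w : ℂ) (φ ψ : 𝓢(ℝ, ℂ)) :
    ((Real.sqrt 2 * w.im : ℝ) : ℂ) * ⟪incl φ, D w (incl ψ)⟫_ℂ
      = ⟪incl (P φ), D w (incl ψ)⟫_ℂ - ⟪incl φ, D w (incl (P ψ))⟫_ℂ := by
  simp only [inner_incl_D]
  have hi := integrable_conj_mul_dispFun w φ ψ
  have hi1 := integrable_conj_mul_dispFun w (P φ) ψ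
  have hi2 := integrable_conj_mul_dispFun w φ (P ψ)
  have e1 : ∀ x, conj (φ x) * (Complex.I * (((Real.sqrt 2 * w.im : ℝ) : ℂ) * dispFun w ψ x
      + dispFun w (P ψ) x)) = Complex.I * ((Real.sqrt 2 * w.im : ℝ) : ℂ) *
        (conj (φ x) * dispFun w ψ x) + Complex.I * (conj (φ x) * dispFun w (P ψ) x) :=
    fun x => by ring
  have e2 : ∀ x, conj (Complex.I * P φ x) * dispFun w ψ x
      = -Complex.I * (conj (P φ x) * dispFun w ψ x) := fun x => by
    rw [map_mul, Complex.conj_I]; ring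
  have h := integral_mul_deriv_eq_deriv_mul_of_integrable (u := fun x => conj (φ x))
    (u' := fun x => conj (Complex.I * P φ x)) (v := dispFun w ψ)
    (fun x _ => (hasDerivAt_schwartz φ x).star)
    (fun x _ => hasDerivAt_dispFun w ψ x)
    (((hi.const_mul _).add (hi2.const_mul _)).congr (Eventually.of_forall fun x => (e1 x).symm))
    ((hi1.const_mul _).congr (Eventually.of_forall fun x => (e2 x).symm)) hi
  simp only [e1, e2] at h
  rw [integral_add (hi.const_mul _) (hi2.const_mul _), integral_const_mul, integral_const_mul,
    integral_const_mul] at h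
  linear_combination (-Complex.I) * h + (((Real.sqrt 2 * w.im : ℝ) : ℂ) *
    (∫ x, conj (φ x) * dispFun w ψ x) + (∫ x, conj (φ x) * dispFun w (P ψ) x)
    - ∫ x, conj (P φ x) * dispFun w ψ x) * Complex.I_sq

/-- Each factor |w| is at most |q| + |p|, and multiplication by q or p is traded for Q or P acting
on φ or ψ. The induction thus has to range over all pairs of Schwartz functions; it starts from |⟨φ,
D(w)ψ⟩| ≤ ‖φ‖‖ψ‖. -/
theorem norm_pow_mul_inner_D_le (n : ℕ) : ∀ φ ψ : 𝓢(ℝ, ℂ), ∃ C, ∀ w,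
    ‖w‖ ^ n * ‖⟪incl φ, D w (incl ψ)⟫_ℂ‖ ≤ C := by
  induction n with
  | zero =>
    refine fun φ ψ => ⟨‖incl φ‖ * ‖incl ψ‖, fun w => ?_⟩
    rw [pow_zero, one_mul]
    refine (norm_inner_le_norm _ _).trans (le_of_eq ?_)
    congr 1
    exact (Diso w).norm_map _
  | succ n ih =>
    intro φ ψ
    obtain ⟨C₁, h₁⟩ := ih (Q φ) ψ
    obtain ⟨C₂, h₂⟩ := ih φ (Q ψ)
    obtain ⟨C₃, h₃⟩ := ih (P φ) ψ
    obtain ⟨C₄, h₄⟩ := ih φ (P ψ)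
    refine ⟨C₁ + C₂ + (C₃ + C₄), fun w => ?_⟩
    have hq := congrArg norm (re_mul_inner_D w φ ψ)
    have hp := congrArg norm (im_mul_inner_D w φ ψ)
    rw [norm_mul, Complex.norm_real, Real.norm_eq_abs, abs_mul,
      abs_of_nonneg (Real.sqrt_nonneg _)] at hq hp
    have hq' := hq.le.trans (norm_sub_le _ _)
    have hp' := hp.le.trans (norm_sub_le _ _)
    have hw : ‖w‖ ≤ Real.sqrt 2 * |w.re| + Real.sqrt 2 * |w.im| := by
      have h1 := Complex.norm_le_abs_re_add_abs_im w
      have h2 : 1 ≤ Real.sqrt 2 := Real.one_le_sqrt.2 one_le_two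
      nlinarith [abs_nonneg w.re, abs_nonneg w.im]
    set N := ‖⟪incl φ, D w (incl ψ)⟫_ℂ‖
    have hN : ‖w‖ * N ≤ Real.sqrt 2 * |w.re| * N + Real.sqrt 2 * |w.im| * N := by
      rw [← add_mul]
      exact mul_le_mul_of_nonneg_right hw (norm_nonneg _)
    calc ‖w‖ ^ (n + 1) * N = ‖w‖ ^ n * (‖w‖ * N) := by ring
      _ ≤ ‖w‖ ^ n * ((‖⟪incl (Q φ), D w (incl ψ)⟫_ℂ‖ + ‖⟪incl φ, D w (incl (Q ψ))⟫_ℂ‖)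
          + (‖⟪incl (P φ), D w (incl ψ)⟫_ℂ‖ + ‖⟪incl φ, D w (incl (P ψ))⟫_ℂ‖)) := by
        gcongr
        linarith
      _ ≤ _ := by
        have a1 := h₁ w
        have a2 := h₂ w
        have a3 := h₃ w
        have a4 := h₄ w
        linarith

theorem integrable_inner_D (φ ψ : 𝓢(ℝ, ℂ)) :
    Integrable (fun w => ⟪incl φ, D w (incl ψ)⟫_ℂ) ν := by
  rw [integrable_nu_iff]
  -- Decay of order 3 exceeds the real dimension 2; the two bounds combine through (1 + t)³ ≤ 4(1 +
  -- t³).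
  obtain ⟨C₀, h₀⟩ := norm_pow_mul_inner_D_le 0 φ ψ
  obtain ⟨C₃, h₃⟩ := norm_pow_mul_inner_D_le 3 φ ψ
  have hr : Integrable fun w : ℂ => (1 + ‖w‖) ^ (-3 : ℝ) :=
    integrable_one_add_norm (by rw [Complex.finrank_real_complex]; norm_num)
  refine (hr.mul_const (4 * (C₀ + C₃))).mono' (continuous_inner_D φ ψ).aestronglyMeasurable
    (Eventually.of_forall fun w => ?_)
  have hpos : 0 < (1 + ‖w‖) ^ 3 := by positivity
  rw [Real.rpow_neg (by positivity), show (3 : ℝ) = ((3 : ℕ) : ℝ) by norm_num, Real.rpow_natCast,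
    inv_mul_eq_div, le_div_iff₀ hpos]
  have a0 := h₀ w
  have a3 := h₃ w
  set N := ‖⟪incl φ, D w (incl ψ)⟫_ℂ‖
  have hN : 0 ≤ N := norm_nonneg _
  have hw : 0 ≤ ‖w‖ := norm_nonneg w
  have h4 : (1 + ‖w‖) ^ 3 ≤ 4 * (1 + ‖w‖ ^ 3) := by
    nlinarith [mul_nonneg (add_nonneg zero_le_one hw) (sq_nonneg (‖w‖ - 1))]
  calc N * (1 + ‖w‖) ^ 3 ≤ N * (4 * (1 + ‖w‖ ^ 3)) := by gcongr
    _ = 4 * (‖w‖ ^ 0 * N + ‖w‖ ^ 3 * N) := by ring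
    _ ≤ _ := by gcongr

theorem raising_sub_lowering_apply (w : ℂ) (ψ : 𝓢(ℝ, ℂ)) (x : ℝ) :
    (w • raising ψ - conj w • lowering ψ) x
      = Complex.I * Real.sqrt 2 * (w.im * Q ψ x - w.re * P ψ x) := by
  have hs : (Real.sqrt 2 : ℂ)⁻¹ = Real.sqrt 2 / 2 := by
    have h : (Real.sqrt 2 : ℂ) * Real.sqrt 2 = 2 := by
      exact_mod_cast Real.mul_self_sqrt (by norm_num : (0 : ℝ) ≤ 2)
    have h0 : (Real.sqrt 2 : ℂ) ≠ 0 := fun h0 => by simp [h0] at h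
    field_simp
    linear_combination -h
  have hw : w = w.re + w.im * Complex.I := (Complex.re_add_im w).symm
  have hcw : conj w = w.re - w.im * Complex.I := by
    apply Complex.ext <;> simp
  have e : (w • raising ψ - conj w • lowering ψ) x
      = w * ((Real.sqrt 2 : ℂ)⁻¹ * (Q ψ x - Complex.I * P ψ x))
        - conj w * ((Real.sqrt 2 : ℂ)⁻¹ * (Q ψ x + Complex.I * P ψ x)) := rfl
  rw [e, hs, hcw]
  nth_rewrite 1 [hw]
  ring

theorem hasFDerivAt_dispFun (ψ : 𝓢(ℝ, ℂ)) (x : ℝ) (w : ℂ) :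
    HasFDerivAt (𝕜 := ℝ) (fun w => dispFun w ψ x)
      ((Complex.I * Real.sqrt 2 * (x - Real.sqrt 2 * w.re / 2) * dispFun w ψ x) •
          (Complex.ofRealCLM ∘L Complex.imCLM)
        + (-Complex.I * (w.im * dispFun w ψ x + Real.sqrt 2 * dispFun w (P ψ) x)) •
          (Complex.ofRealCLM ∘L Complex.reCLM)) w := by
  have hre : HasFDerivAt (fun w : ℂ => w.re) Complex.reCLM w := Complex.reCLM.hasFDerivAt
  have him : HasFDerivAt (fun w : ℂ => w.im) Complex.imCLM w := Complex.imCLM.hasFDerivAt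
  have h1 := him.const_mul (Real.sqrt 2)
  have h2 := ((hre.const_mul (Real.sqrt 2)).mul_const (2⁻¹ : ℝ)).const_sub x
  have h3 := ((Complex.ofRealCLM.hasFDerivAt.comp w (h1.mul h2)).const_mul Complex.I).cexp
  have h4 := (hasDerivAt_schwartz ψ (x - Real.sqrt 2 * w.re)).hasFDerivAt.comp w
    ((hre.const_mul (Real.sqrt 2)).const_sub x)
  refine (h3.mul h4).congr_fderiv ?_
  have hs : (Real.sqrt 2 : ℂ) * Real.sqrt 2 = 2 := by
    exact_mod_cast Real.mul_self_sqrt (by norm_num : (0 : ℝ) ≤ 2)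
  ext v
  simp only [dispFun, Function.comp_apply, _root_.smul_apply, _root_.add_apply,
    _root_.neg_apply, ContinuousLinearMap.comp_apply, Complex.ofRealCLM_apply,
    Complex.reCLM_apply, Complex.imCLM_apply, smul_eq_mul,
    ContinuousLinearMap.toSpanSingleton_apply, Complex.real_smul, Pi.mul_apply,
    ← div_eq_mul_inv]
  generalize Complex.exp _ = E
  push_cast
  linear_combination (-1 / 2 * E * Complex.I * v.re * ψ (x - Real.sqrt 2 * w.re) * w.im) * hs

/-- Differentiation under the integral sign. The generator of D at 0 in the direction w is i(pQ -
qP) = w a† - w̄ a. -/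
theorem hasFDerivAt_inner_D (φ ψ : 𝓢(ℝ, ℂ)) : ∃ L : ℂ →L[ℝ] ℂ,
    HasFDerivAt (fun w => ⟪incl φ, D w (incl ψ)⟫_ℂ) L 0 ∧
    ∀ w, L w = ⟪incl φ, incl (raising ψ)⟫_ℂ * w - ⟪incl φ, incl (lowering ψ)⟫_ℂ * conj w := by
  obtain ⟨C, hC0, hC⟩ := exists_bound ψ
  obtain ⟨C', hC0', hC'⟩ := exists_bound (P ψ)
  have hs0 : 0 ≤ Real.sqrt 2 := Real.sqrt_nonneg 2
  have hs2 : Real.sqrt 2 ≤ 2 := by rw [Real.sqrt_le_left] <;> norm_num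
  have hφc := φ.continuous
  have hψc := ψ.continuous
  have hPc := (P ψ).continuous
  set F' : ℂ → ℝ → ℂ →L[ℝ] ℂ := fun w x => conj (φ x) •
      ((Complex.I * Real.sqrt 2 * (x - Real.sqrt 2 * w.re / 2) * dispFun w ψ x) •
          (Complex.ofRealCLM ∘L Complex.imCLM)
        + (-Complex.I * (w.im * dispFun w ψ x + Real.sqrt 2 * dispFun w (P ψ) x)) •
          (Complex.ofRealCLM ∘L Complex.reCLM)) with hF'
  have hcl : ∀ T : ℂ →L[ℝ] ℝ, ‖T‖ ≤ 1 → ‖Complex.ofRealCLM ∘L T‖ ≤ 1 := fun T hT =>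
    ContinuousLinearMap.opNorm_le_bound _ zero_le_one fun v => by
      rw [ContinuousLinearMap.comp_apply, Complex.ofRealCLM_apply, Complex.norm_real]
      exact (T.le_of_opNorm_le hT v)
  have him : ‖Complex.ofRealCLM ∘L Complex.imCLM‖ ≤ 1 := hcl _ Complex.imCLM_norm.le
  have hre : ‖Complex.ofRealCLM ∘L Complex.reCLM‖ ≤ 1 := hcl _ Complex.reCLM_norm.le
  -- Dominates `F'` for |w| < 1, using √2 ≤ 2; the decay of φ absorbs the linear growth in x.
  set bound : ℝ → ℝ := fun x => ‖φ x‖ * (2 * (‖x‖ + 1) * C + (C + 2 * C')) with hbound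
  have hbi : Integrable bound := by
    have h1 := (φ.integrable_pow_mul volume 1).mul_const (2 * C)
    have h0 := (φ.integrable (μ := volume)).norm.mul_const (2 * C + (C + 2 * C'))
    refine (h1.add h0).congr (Eventually.of_forall fun x => ?_)
    simp only [Pi.add_apply, hbound]
    ring
  have hle : ∀ x, ∀ w ∈ Metric.ball (0 : ℂ) 1, ‖F' w x‖ ≤ bound x := fun x w hw => by
    have hw1 : ‖w‖ ≤ 1 := (mem_ball_zero_iff.1 hw).le
    have hwre := (Complex.abs_re_le_norm w).trans hw1
    have hwim := (Complex.abs_im_le_norm w).trans hw1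
    rw [hF', norm_smul, RCLike.norm_conj]
    refine mul_le_mul_of_nonneg_left ((norm_add_le _ _).trans (add_le_add ?_ ?_)) (norm_nonneg _)
    · rw [norm_smul]
      refine (mul_le_of_le_one_right (norm_nonneg _) him).trans ?_
      rw [norm_mul, norm_mul, norm_mul, Complex.norm_I, one_mul, norm_dispFun, Complex.norm_real,
        Real.norm_eq_abs, abs_of_nonneg hs0]
      have hx : ‖(x - Real.sqrt 2 * w.re / 2 : ℂ)‖ ≤ ‖x‖ + 1 := by
        refine (norm_sub_le _ _).trans (add_le_add (Complex.norm_real x).le ?_)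
        rw [norm_div, norm_mul, Complex.norm_real, Complex.norm_real, Real.norm_eq_abs,
          Real.norm_eq_abs, abs_of_nonneg hs0, Complex.norm_ofNat, div_le_one two_pos]
        nlinarith [abs_nonneg w.re]
      gcongr
      exact hC _
    · rw [norm_smul]
      refine (mul_le_of_le_one_right (norm_nonneg _) hre).trans ?_
      rw [norm_mul, norm_neg, Complex.norm_I, one_mul]
      refine (norm_add_le _ _).trans (add_le_add ?_ ?_)
      · rw [norm_mul, Complex.norm_real, Real.norm_eq_abs, norm_dispFun]
        exact (mul_le_of_le_one_left (norm_nonneg _) hwim).trans (hC _)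
      · rw [norm_mul, Complex.norm_real, Real.norm_eq_abs, norm_dispFun, abs_of_nonneg hs0]
        gcongr
        exact hC' _
  have hm : AEStronglyMeasurable (F' 0) := by
    have h1 := continuous_dispFun 0 ψ
    have h2 := continuous_dispFun 0 (P ψ)
    exact Continuous.aestronglyMeasurable (by fun_prop)
  have hball : Metric.ball (0 : ℂ) 1 ∈ 𝓝 (0 : ℂ) := Metric.ball_mem_nhds 0 one_pos
  have hd := hasFDerivAt_integral_of_dominated_of_fderiv_le (𝕜 := ℝ) (x₀ := (0 : ℂ))
    (F := fun w x => conj (φ x) * dispFun w ψ x) (F' := F') (bound := bound) hball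
    (Eventually.of_forall fun w => (integrable_conj_mul_dispFun w φ ψ).1)
    (integrable_conj_mul_dispFun 0 φ ψ) hm (Eventually.of_forall hle) hbi
    (Eventually.of_forall fun x w _ => (hasFDerivAt_dispFun ψ x w).const_mul _)
  have hi : Integrable (F' 0) :=
    hbi.mono' hm (Eventually.of_forall fun x => hle x 0 (Metric.mem_ball_self one_pos))
  refine ⟨_, by simpa only [inner_incl_D] using hd, fun w => ?_⟩
  rw [ContinuousLinearMap.integral_apply hi, mul_comm _ w, mul_comm _ (conj w),
    ← inner_smul_right, ← inner_smul_right, ← inner_sub_right, ← map_smul incl, ← map_smul incl,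
    ← map_sub, inner_incl]
  congr 1; ext x
  rw [raising_sub_lowering_apply, hF', Q_apply]
  simp [dispFun]
  ring

variable {𝒟 : FormDomain}

/-! ### Lowering, raising, position and momentum -/

theorem sqrt_two_ne_zero : (Real.sqrt 2 : ℂ) ≠ 0 := by
  exact_mod_cast (Real.sqrt_pos.2 two_pos).ne'

theorem sqrt_two_mul_self : (Real.sqrt 2 : ℂ) * Real.sqrt 2 = 2 := by
  exact_mod_cast Real.mul_self_sqrt (by norm_num : (0 : ℝ) ≤ 2)

theorem inv_sqrt_two_mul_self : (Real.sqrt 2 : ℂ)⁻¹ * (Real.sqrt 2 : ℂ)⁻¹ = 1 / 2 := by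
  rw [← mul_inv, sqrt_two_mul_self, one_div]

theorem lowering_apply (ψ : 𝓢(ℝ, ℂ)) :
    lowering ψ = (Real.sqrt 2 : ℂ)⁻¹ • (Q ψ + Complex.I • P ψ) := rfl

theorem raising_apply (ψ : 𝓢(ℝ, ℂ)) :
    raising ψ = (Real.sqrt 2 : ℂ)⁻¹ • (Q ψ - Complex.I • P ψ) := rfl

theorem position_eq : (Real.sqrt 2 : ℂ)⁻¹ • (lowering + raising) = Q := by
  refine LinearMap.ext fun ψ => ?_
  rw [LinearMap.smul_apply, LinearMap.add_apply, lowering_apply, raising_apply, ← smul_add,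
    smul_smul, inv_sqrt_two_mul_self]
  module

theorem momentum_eq : (Complex.I * Real.sqrt 2 : ℂ)⁻¹ • (lowering - raising) = P := by
  refine LinearMap.ext fun ψ => ?_
  rw [LinearMap.smul_apply, LinearMap.sub_apply, lowering_apply, raising_apply, ← smul_sub,
    smul_smul, mul_inv, mul_assoc, inv_sqrt_two_mul_self, Complex.inv_I]
  match_scalars
  · ring
  · linear_combination -Complex.I_sq

theorem Q_P_sub_P_Q (ψ : 𝓢(ℝ, ℂ)) : Q (P ψ) - P (Q ψ) = Complex.I • ψ := by
  ext x
  have h : HasDerivAt (Q ψ) (1 * ψ x + (x : ℂ) * (Complex.I * P ψ x)) x := by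
    have h1 := (Complex.ofRealCLM.hasDerivAt (x := x)).mul (hasDerivAt_schwartz ψ x)
    have e : (Q ψ : ℝ → ℂ) = Complex.ofRealCLM * ψ := by
      ext y
      exact Q_apply ψ y
    rw [e]
    simpa using h1
  change Q (P ψ) x - P (Q ψ) x = Complex.I * ψ x
  rw [P_apply, h.deriv, Q_apply]
  linear_combination ((x : ℂ) * P ψ x) * Complex.I_sq

theorem lowering_raising_sub (ψ : 𝓢(ℝ, ℂ)) :
    lowering (raising ψ) - raising (lowering ψ) = (1 : ℂ) • ψ := by
  have h : lowering (raising ψ) - raising (lowering ψ)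
      = ((Real.sqrt 2 : ℂ)⁻¹ * (Real.sqrt 2 : ℂ)⁻¹) •
        (-(2 * Complex.I)) • (Q (P ψ) - P (Q ψ)) := by
    simp only [lowering_apply, raising_apply, map_smul, map_add, map_sub]
    module
  rw [h, Q_P_sub_P_Q, inv_sqrt_two_mul_self, smul_smul, smul_smul]
  congr 1
  linear_combination -Complex.I_sq

/-- The case w = 0 of `re_mul_inner_D`, where D(0) = I. -/
theorem inner_Q (φ ψ : 𝓢(ℝ, ℂ)) : ⟪incl (Q φ), incl ψ⟫_ℂ = ⟪incl φ, incl (Q ψ)⟫_ℂ := by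
  have h := re_mul_inner_D 0 φ ψ
  simp only [D_zero, Complex.zero_re, mul_zero, Complex.ofReal_zero, zero_mul] at h
  exact (sub_eq_zero.1 h.symm)

theorem inner_P (φ ψ : 𝓢(ℝ, ℂ)) : ⟪incl (P φ), incl ψ⟫_ℂ = ⟪incl φ, incl (P ψ)⟫_ℂ := by
  have h := im_mul_inner_D 0 φ ψ
  simp only [D_zero, Complex.zero_im, mul_zero, Complex.ofReal_zero, zero_mul] at h
  exact (sub_eq_zero.1 h.symm)

theorem inner_lowering (φ ψ : 𝓢(ℝ, ℂ)) :
    ⟪incl (lowering φ), incl ψ⟫_ℂ = ⟪incl φ, incl (raising ψ)⟫_ℂ := by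
  simp only [lowering_apply, raising_apply, map_smul, map_add, map_sub, inner_smul_left,
    inner_smul_right, inner_add_left, inner_sub_right, inner_Q, inner_P, Complex.conj_I,
    map_inv₀, Complex.conj_ofReal]
  ring

theorem FormDomain.lowering_mem (𝒟 : FormDomain) {φ : 𝓢(ℝ, ℂ)} (hφ : φ ∈ 𝒟.space) :
    lowering φ ∈ 𝒟.space :=
  𝒟.space.smul_mem _ (𝒟.space.add_mem (𝒟.Q_mem φ hφ) (𝒟.space.smul_mem _ (𝒟.P_mem φ hφ)))

theorem FormDomain.raising_mem (𝒟 : FormDomain) {φ : 𝓢(ℝ, ℂ)} (hφ : φ ∈ 𝒟.space) :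
    raising φ ∈ 𝒟.space :=
  𝒟.space.smul_mem _ (𝒟.space.sub_mem (𝒟.Q_mem φ hφ) (𝒟.space.smul_mem _ (𝒟.P_mem φ hφ)))

theorem commutatorEq_op {S T : 𝓢(ℝ, ℂ) →ₗ[ℂ] 𝓢(ℝ, ℂ)} {c : ℂ}
    (hS : ∀ φ ∈ 𝒟.space, S φ ∈ 𝒟.space) (hT : ∀ φ ∈ 𝒟.space, T φ ∈ 𝒟.space)
    (h : ∀ φ, S (T φ) - T (S φ) = c • φ) : CommutatorEq (𝒟.op S) (𝒟.op T) 𝒟.dom c := by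
  rintro _ ⟨ψ, hψ, rfl⟩
  have hSψ : 𝒟.op S ⟨incl ψ, Submodule.mem_map_of_mem hψ⟩ ∈ (𝒟.op T).domain := by
    rw [FormDomain.op_apply 𝒟 S ψ hψ]
    exact Submodule.mem_map_of_mem (hS ψ hψ)
  have hTψ : 𝒟.op T ⟨incl ψ, Submodule.mem_map_of_mem hψ⟩ ∈ (𝒟.op S).domain := by
    rw [FormDomain.op_apply 𝒟 T ψ hψ]
    exact Submodule.mem_map_of_mem (hT ψ hψ)
  refine ⟨Submodule.mem_map_of_mem hψ, Submodule.mem_map_of_mem hψ, hSψ, hTψ, ?_⟩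
  have e1 : (⟨_, hTψ⟩ : (𝒟.op S).domain)
      = ⟨incl (T ψ), Submodule.mem_map_of_mem (hT ψ hψ)⟩ :=
    Subtype.ext (FormDomain.op_apply 𝒟 T ψ hψ)
  have e2 : (⟨_, hSψ⟩ : (𝒟.op T).domain)
      = ⟨incl (S ψ), Submodule.mem_map_of_mem (hS ψ hψ)⟩ :=
    Subtype.ext (FormDomain.op_apply 𝒟 S ψ hψ)
  have h1 : 𝒟.op S ⟨_, hTψ⟩ = incl (S (T ψ)) := by
    rw [e1, FormDomain.op_apply 𝒟 S (T ψ) (hT ψ hψ)]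
  have h2 : 𝒟.op T ⟨_, hSψ⟩ = incl (T (S ψ)) := by
    rw [e2, FormDomain.op_apply 𝒟 T (S ψ) (hS ψ hψ)]
  rw [h1, h2, ← map_sub, h, map_smul]

/-! ### The sesquilinear forms -/

theorem FormDomain.dense_dom (𝒟 : FormDomain) : Dense (𝒟.dom : Set H) := by
  simpa [FormDomain.dom, Submodule.map_coe] using 𝒟.dense

theorem integral_neg_nu (f : ℂ → ℂ) : ∫ w, f (-w) ∂ν = ∫ w, f w ∂ν := by
  rw [integral_nu, integral_nu, integral_neg_eq_self]

theorem formMz_eq (ϖ : ℂ → ℂ) (z : ℂ) (φ ψ : H) :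
    formMz ϖ z φ ψ
      = ∫ w, Complex.exp (z * conj w - conj z * w) * (ϖ w * ⟪φ, D w ψ⟫_ℂ) ∂ν := by
  simp only [formMz, formM, inner_displaced]
  congr 1; ext w; ring

/-- Conjugation turns D(w) into D(w)† = D(-w); the substitution w ↦ -w undoes this, and a real even
weight is unaffected by both. -/
theorem formM_conj {ϖ : ℂ → ℂ} (hϖ : IsRegularWeight ϖ) (φ ψ : H) :
    conj (formM ϖ ψ φ) = formM ϖ φ ψ := by
  rw [formM, formM, ← integral_conj, ← integral_neg_nu]
  congr 1; ext w
  rw [map_mul, hϖ.real, hϖ.even, inner_conj_symm, ← adjoint_D, Dadj,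
    ContinuousLinearMap.adjoint_inner_left]

theorem formMz_conj {ϖ : ℂ → ℂ} (hϖ : IsRegularWeight ϖ) (z : ℂ) (φ ψ : H) :
    conj (formMz ϖ z ψ φ) = formMz ϖ z φ ψ :=
  formM_conj hϖ _ _

theorem HasForm.conj_symm {ϖ f : ℂ → ℂ} (hϖ : IsRegularWeight ϖ) {φ ψ : H} {c : ℂ}
    (h : HasForm ϖ f ψ φ c) : HasForm ϖ (fun z => conj (f z)) φ ψ (conj c) := by
  have e : ∀ (ε : ℝ) (z : ℂ),
      (Real.exp (-ε * ‖z‖ ^ 2) : ℂ) * (formMz ϖ z φ ψ * conj (f z))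
        = conj ((Real.exp (-ε * ‖z‖ ^ 2) : ℂ) * (formMz ϖ z ψ φ * f z)) := fun ε z => by
    rw [map_mul, map_mul, formMz_conj hϖ, Complex.conj_ofReal]
  constructor
  · intro ε hε
    simp only [e]
    exact (LinearIsometryEquiv.integrable_comp_iff Complex.conjLIE).2 (h.integrable ε hε)
  · simp only [e, integral_conj]
    exact (Complex.continuous_conj.tendsto c).comp h.tendsto

theorem HasForm.linear_combination {ϖ f g : ℂ → ℂ} {φ ψ : H} {c d : ℂ} (a b : ℂ)
    (hf : HasForm ϖ f φ ψ c) (hg : HasForm ϖ g φ ψ d) :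
    HasForm ϖ (fun z => a * f z + b * g z) φ ψ (a * c + b * d) := by
  have e : ∀ (ε : ℝ) (z : ℂ),
      (Real.exp (-ε * ‖z‖ ^ 2) : ℂ) * (formMz ϖ z φ ψ * (a * f z + b * g z))
        = a * ((Real.exp (-ε * ‖z‖ ^ 2) : ℂ) * (formMz ϖ z φ ψ * f z))
          + b * ((Real.exp (-ε * ‖z‖ ^ 2) : ℂ) * (formMz ϖ z φ ψ * g z)) := fun ε z => by
    ring
  constructor
  · intro ε hε
    simp only [e]
    exact ((hf.integrable ε hε).const_mul a).add ((hg.integrable ε hε).const_mul b)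
  · refine ((hf.tendsto.const_mul a).add (hg.tendsto.const_mul b)).congr' ?_
    filter_upwards [self_mem_nhdsWithin] with ε hε
    simp only [e]
    rw [integral_add ((hf.integrable ε hε).const_mul a) ((hg.integrable ε hε).const_mul b),
      integral_const_mul, integral_const_mul]

/-! ### The form of the quantized coordinate function -/

/-- The phase has modulus 1, so the integrand is dominated by a product of integrable functions of z
and of w; the Gaussian supplies the integrability in z that Fubini requires. -/
theorem integrable_kernel {ε : ℝ} (hε : 0 < ε) {g : ℂ → ℂ} (hg : Integrable g ν) :
    Integrable (fun x : ℂ × ℂ => (Real.exp (-ε * ‖x.1‖ ^ 2) : ℂ) *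
      Complex.exp (x.1 * conj x.2 - conj x.1 * x.2) * x.1 * g x.2) (ν.prod ν) := by
  have h1 : Integrable (fun z : ℂ => (Real.exp (-ε * ‖z‖ ^ 2) : ℂ) * z) ν := by
    rw [integrable_nu_iff]
    simpa using integrable_gaussian_symplectic_mul hε 0
  refine ((h1.mul_prod hg).bdd_mul (c := 1)
    (f := fun x : ℂ × ℂ => Complex.exp (x.1 * conj x.2 - conj x.1 * x.2))
    (Continuous.aestronglyMeasurable (by fun_prop))
    (Eventually.of_forall fun x => (norm_symplectic x.1 x.2).le)).congr
    (Eventually.of_forall fun x => ?_)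
  simp only
  ring

/-- Write c l = l + (c - 1) l: the last term is o(1) · O(w) = o(w). -/
theorem hasFDerivAt_mul_of_continuousAt {c l : ℂ → ℂ} {L : ℂ →L[ℝ] ℂ} (hc : ContinuousAt c 0)
    (hc0 : c 0 = 1) (hl : HasFDerivAt l L 0) (hl0 : l 0 = 0) :
    HasFDerivAt (fun w => c w * l w) L 0 := by
  rw [hasFDerivAt_iff_isLittleO_nhds_zero] at hl ⊢
  simp only [zero_add, hl0, mul_zero, sub_zero] at hl ⊢
  have h1 : l =O[𝓝 0] fun w : ℂ => w := by
    have := hl.isBigO.add (L.isBigO_id (𝓝 0))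
    simpa using this
  have h2 : (fun w => c w - 1) =o[𝓝 0] fun _ : ℂ => (1 : ℂ) := by
    rw [Asymptotics.isLittleO_one_iff]
    have := hc.tendsto.sub_const (1 : ℂ)
    rwa [hc0, sub_self] at this
  have h3 := hl.add (by simpa using h2.mul_isBigO h1)
  refine h3.congr_left fun w => ?_
  ring

theorem hasForm_coordinate (ϖ : Weight 𝒟) (hϖ : IsRegularWeight ϖ.toFun) {φ ψ : 𝓢(ℝ, ℂ)}
    (hφ : φ ∈ 𝒟.space) (hψ : ψ ∈ 𝒟.space) :
    HasForm ϖ.toFun (fun z => z) (incl φ) (incl ψ) ⟪incl φ, incl (lowering ψ)⟫_ℂ := by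
  set h : ℂ → ℂ := fun w => ⟪incl φ, D w (incl ψ)⟫_ℂ with hh
  set g : ℂ → ℂ := fun w => ϖ.toFun w * h w with hg
  have hgi : Integrable g ν :=
    ϖ.integrable _ (Submodule.mem_map_of_mem hφ) _ (Submodule.mem_map_of_mem hψ)
  set Φ : ℝ → ℂ × ℂ → ℂ := fun ε x => (Real.exp (-ε * ‖x.1‖ ^ 2) : ℂ) *
    Complex.exp (x.1 * conj x.2 - conj x.1 * x.2) * x.1 * g x.2 with hΦ
  have e : ∀ (ε : ℝ) (z : ℂ), (Real.exp (-ε * ‖z‖ ^ 2) : ℂ) *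
      (formMz ϖ.toFun z (incl φ) (incl ψ) * z) = ∫ w, Φ ε (z, w) ∂ν := fun ε z => by
    rw [formMz_eq, ← integral_mul_const, ← integral_const_mul]
    congr 1; ext w
    simp only [hΦ, hg, hh]
    ring
  have hΦi : ∀ ε : ℝ, 0 < ε → Integrable (Φ ε) (ν.prod ν) := fun ε hε => integrable_kernel hε hgi
  set K : ℝ → ℂ → ℂ := fun ε w => w / ε ^ 2 * (Real.exp (-‖w‖ ^ 2 / ε) : ℂ) with hK
  have hΦz : ∀ ε : ℝ, 0 < ε → ∀ w, ∫ z, Φ ε (z, w) ∂ν = -(g w * K ε w) := fun ε hε w => by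
    simp only [hΦ]
    rw [integral_mul_const, integral_gaussian_symplectic_mul hε]
    simp only [hK]; ring
  refine ⟨fun ε hε => ?_, ?_⟩
  · simp only [e]
    exact (hΦi ε hε).integral_prod_left
  -- Since ϖ is even, `k` is the odd part of `g`. It has the same integral as `g` against the odd
  -- kernel `K ε`, and unlike `g` it is certain to be differentiable at 0.
  set k : ℂ → ℂ := fun w => ϖ.toFun w * ((h w - h (-w)) / 2) with hk
  have hgn : Integrable (fun w => g (-w)) ν := integrable_nu_iff.2 (integrable_nu_iff.1 hgi).comp_neg
  have hkg : ∀ w, k w = (g w - g (-w)) / 2 := fun w => by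
    simp only [hk, hg, hϖ.even]; ring
  have hki : Integrable k ν := ((hgi.sub hgn).div_const 2).congr
    (Eventually.of_forall fun w => (hkg w).symm)
  obtain ⟨L, hL, hLe⟩ := hasFDerivAt_inner_D φ ψ
  -- Taking the odd part leaves the derivative at 0 unchanged, because that derivative is itself
  -- odd.
  have hl : HasFDerivAt (fun w => (h w - h (-w)) / 2) L 0 := by
    have hL' : HasFDerivAt h L (-0 : ℂ) := by simpa using hL
    have h1 := (hL.sub (hL'.comp (0 : ℂ) (hasFDerivAt_id (𝕜 := ℝ) (0 : ℂ)).neg)).mul_const (2⁻¹ : ℂ)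
    have h2 := h1.congr_fderiv (g' := L) (by
      ext v
      simp
      ring)
    exact h2
  have hkd := hasFDerivAt_mul_of_continuousAt ϖ.continuousAt_zero ϖ.at_zero hl (by simp)
  have hlim := (tendsto_gaussian_first_moment (β := -⟪incl φ, incl (lowering ψ)⟫_ℂ) hki
    (by simp [hk]) hkd (fun w => by rw [hLe]; ring)).neg
  rw [neg_neg] at hlim
  refine hlim.congr' ?_
  filter_upwards [self_mem_nhdsWithin] with ε hε
  simp only [e]
  rw [integral_integral_swap (f := fun z w => Φ ε (z, w)) (hΦi ε hε)]
  simp only [hΦz ε hε]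
  have hgK : Integrable (fun w => g w * K ε w) ν := by
    have := (hΦi ε hε).integral_prod_right
    simp only [hΦz ε hε] at this
    simpa using this.neg
  have hodd : ∀ w, g (-w) * K ε w = -(g (-w) * K ε (-w)) := fun w => by
    simp only [hK, norm_neg]; ring
  have hgK' : Integrable (fun w => g (-w) * K ε w) ν := by
    simp only [hodd]
    exact (integrable_nu_iff.2 (integrable_nu_iff.1 hgK).comp_neg).neg
  have hneg : ∫ w, g (-w) * K ε w ∂ν = -∫ w, g w * K ε w ∂ν := by
    simp only [hodd, integral_neg]
    rw [integral_neg_nu fun w => g w * K ε w]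
  have hfin : ∫ w, k w * K ε w ∂ν = ∫ w, g w * K ε w ∂ν := by
    have : ∀ w, k w * K ε w = (g w * K ε w - g (-w) * K ε w) / 2 := fun w => by
      rw [hkg]; ring
    simp only [this]
    rw [integral_div, integral_sub hgK hgK', hneg]
    ring
  rw [integral_neg, ← hfin]

theorem hasForm_conj_coordinate (ϖ : Weight 𝒟) (hϖ : IsRegularWeight ϖ.toFun) {φ ψ : 𝓢(ℝ, ℂ)}
    (hφ : φ ∈ 𝒟.space) (hψ : ψ ∈ 𝒟.space) :
    HasForm ϖ.toFun (fun z => conj z) (incl φ) (incl ψ) ⟪incl φ, incl (raising ψ)⟫_ℂ := by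
  have h := (hasForm_coordinate ϖ hϖ hψ hφ).conj_symm hϖ
  rwa [inner_conj_symm, inner_lowering] at h

theorem hasForm_position (ϖ : Weight 𝒟) (hϖ : IsRegularWeight ϖ.toFun) {φ ψ : 𝓢(ℝ, ℂ)}
    (hφ : φ ∈ 𝒟.space) (hψ : ψ ∈ 𝒟.space) :
    HasForm ϖ.toFun (fun z => ((Real.sqrt 2 * z.re : ℝ) : ℂ)) (incl φ) (incl ψ)
      ⟪incl φ, incl (Q ψ)⟫_ℂ := by
  have h := (hasForm_coordinate ϖ hϖ hφ hψ).linear_combination (Real.sqrt 2 : ℂ)⁻¹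
    (Real.sqrt 2 : ℂ)⁻¹ (hasForm_conj_coordinate ϖ hϖ hφ hψ)
  convert h using 1
  · ext z
    rw [← mul_add, Complex.add_conj, eq_inv_mul_iff_mul_eq₀ sqrt_two_ne_zero]
    push_cast
    linear_combination (z.re : ℂ) * sqrt_two_mul_self
  · rw [← position_eq, ← mul_add, ← inner_add_right, ← inner_smul_right, ← map_add, ← map_smul]
    rfl

theorem hasForm_momentum (ϖ : Weight 𝒟) (hϖ : IsRegularWeight ϖ.toFun) {φ ψ : 𝓢(ℝ, ℂ)}
    (hφ : φ ∈ 𝒟.space) (hψ : ψ ∈ 𝒟.space) :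
    HasForm ϖ.toFun (fun z => ((Real.sqrt 2 * z.im : ℝ) : ℂ)) (incl φ) (incl ψ)
      ⟪incl φ, incl (P ψ)⟫_ℂ := by
  have h := (hasForm_coordinate ϖ hϖ hφ hψ).linear_combination (Complex.I * Real.sqrt 2 : ℂ)⁻¹
    (-(Complex.I * Real.sqrt 2 : ℂ)⁻¹) (hasForm_conj_coordinate ϖ hϖ hφ hψ)
  convert h using 1
  · ext z
    rw [neg_mul, ← sub_eq_add_neg, ← mul_sub, Complex.sub_conj,
      eq_inv_mul_iff_mul_eq₀ (mul_ne_zero Complex.I_ne_zero sqrt_two_ne_zero)]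
    push_cast
    linear_combination (Complex.I * z.im : ℂ) * sqrt_two_mul_self
  · rw [← momentum_eq, neg_mul, ← sub_eq_add_neg, ← mul_sub, ← inner_sub_right,
      ← inner_smul_right, ← map_sub, ← map_smul]
    rfl

/-! ### The quantum operators -/

theorem mem_A_graph {ϖ : Weight 𝒟} {f : ℂ → ℂ} {x : H × H} :
    x ∈ (A ϖ f).graph ↔
      x.1 ∈ 𝒟.dom ∧ ∀ φ ∈ 𝒟.dom, HasForm ϖ.toFun f φ x.1 ⟪φ, x.2⟫_ℂ := by
  rw [A_graph]; rfl

theorem A_mem_dom {ϖ : Weight 𝒟} {f : ℂ → ℂ} (ψ : (A ϖ f).domain) : (ψ : H) ∈ 𝒟.dom :=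
  (mem_A_graph.1 ((A ϖ f).mem_graph ψ)).1

theorem hasForm_A {ϖ : Weight 𝒟} {f : ℂ → ℂ} (ψ : (A ϖ f).domain) {φ : H} (hφ : φ ∈ 𝒟.dom) :
    HasForm ϖ.toFun f φ ψ ⟪φ, A ϖ f ψ⟫_ℂ :=
  (mem_A_graph.1 ((A ϖ f).mem_graph ψ)).2 φ hφ

/-- The comparison of graphs settles the domains as well: Tψ is an admissible χ for every ψ in the
domain, and density makes it the only one. -/
theorem A_eq_op {ϖ : Weight 𝒟} {f : ℂ → ℂ} {T : 𝓢(ℝ, ℂ) →ₗ[ℂ] 𝓢(ℝ, ℂ)}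
    (h : ∀ φ ∈ 𝒟.space, ∀ ψ ∈ 𝒟.space,
      HasForm ϖ.toFun f (incl φ) (incl ψ) ⟪incl φ, incl (T ψ)⟫_ℂ) : A ϖ f = 𝒟.op T := by
  refine LinearPMap.eq_of_eq_graph (Submodule.ext fun ⟨x, y⟩ => ?_)
  rw [mem_A_graph, LinearPMap.mem_graph_iff]
  constructor
  · rintro ⟨⟨ψ, hψ, rfl⟩, hy⟩
    refine ⟨⟨incl ψ, Submodule.mem_map_of_mem hψ⟩, rfl, ?_⟩
    rw [FormDomain.op_apply 𝒟 T ψ hψ]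
    refine 𝒟.dense_dom.eq_of_inner_right ℂ ?_
    rintro _ ⟨φ, hφ, rfl⟩
    exact (h φ hφ ψ hψ).unique (hy _ (Submodule.mem_map_of_mem hφ))
  · rintro ⟨⟨_, ψ, hψ, rfl⟩, rfl, rfl⟩
    refine ⟨Submodule.mem_map_of_mem hψ, ?_⟩
    rintro _ ⟨φ, hφ, rfl⟩
    simp only
    rw [FormDomain.op_apply 𝒟 T ψ hψ]
    exact h φ hφ ψ hψ

theorem isFormalAdjoint_A (ϖ : Weight 𝒟) (hϖ : IsRegularWeight ϖ.toFun) (f : ℂ → ℂ) :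
    (A ϖ f).IsFormalAdjoint (A ϖ fun z => conj (f z)) := fun x y => by
  have h1 := (hasForm_A x (A_mem_dom y)).conj_symm hϖ
  rw [inner_conj_symm] at h1
  exact h1.unique (hasForm_A y (A_mem_dom x))

theorem mem_domRestrict_graph {T : H →ₗ.[ℂ] H} {S : Submodule ℂ H} {x y : H} :
    (x, y) ∈ (T.domRestrict S).graph ↔ x ∈ S ∧ (x, y) ∈ T.graph := by
  simp only [LinearPMap.mem_graph_iff]
  constructor
  · rintro ⟨ψ, rfl, rfl⟩
    exact ⟨ψ.2.1, ⟨ψ, ψ.2.2⟩, rfl, (LinearPMap.domRestrict_apply rfl).symm⟩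
  · rintro ⟨hS, ψ, rfl, rfl⟩
    exact ⟨⟨ψ, hS, ψ.2⟩, rfl, LinearPMap.domRestrict_apply rfl⟩

/-- One inclusion is formal adjointness. For the other, if ψ lies in 𝒟 and in the domain of A_f†,
then B_f(ψ, φ) = ⟨ψ, A_f φ⟩ = ⟨A_f†ψ, φ⟩ for every φ in 𝒟, and conjugating gives B_{f̄}(φ, ψ) = ⟨φ,
A_f†ψ⟩. Both the density of the domain and the freedom to test with every φ come from A_f being
defined on all of 𝒟. -/
theorem A_conj_eq_adjoint (ϖ : Weight 𝒟) (hϖ : IsRegularWeight ϖ.toFun) (f : ℂ → ℂ)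
    (hf : (A ϖ f).domain = 𝒟.dom) :
    (A ϖ fun z => conj (f z)) = (A ϖ f).adjoint.domRestrict 𝒟.dom := by
  have hd : Dense ((A ϖ f).domain : Set H) := by
    rw [hf]; exact 𝒟.dense_dom
  have hfa := isFormalAdjoint_A ϖ hϖ f
  refine LinearPMap.eq_of_eq_graph (Submodule.ext fun ⟨x, y⟩ => ?_)
  rw [mem_domRestrict_graph, LinearPMap.mem_graph_iff (f := (A ϖ f).adjoint)]
  constructor
  · intro h
    obtain ⟨ψ, rfl, rfl⟩ := LinearPMap.mem_graph_iff _ |>.1 h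
    have hi : ∀ φ : (A ϖ f).domain,
        ⟪(A ϖ fun z => conj (f z)) ψ, (φ : H)⟫_ℂ = ⟪(ψ : H), A ϖ f φ⟫_ℂ := fun φ => by
      rw [← inner_conj_symm, ← hfa φ ψ, inner_conj_symm]
    have hmem := LinearPMap.mem_adjoint_domain_of_exists (T := A ϖ f) (ψ : H) ⟨_, hi⟩
    exact ⟨A_mem_dom ψ, ⟨ψ, hmem⟩, rfl, LinearPMap.adjoint_apply_eq hd ⟨ψ, hmem⟩ hi⟩
  · rintro ⟨hψ, ψ, rfl, rfl⟩
    rw [mem_A_graph]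
    refine ⟨hψ, fun φ hφ => ?_⟩
    have h1 := (hasForm_A (ϖ := ϖ) (f := f) ⟨φ, hf ▸ hφ⟩ hψ).conj_symm hϖ
    rw [← LinearPMap.adjoint_isFormalAdjoint hd ψ ⟨φ, hf ▸ hφ⟩, inner_conj_symm] at h1
    exact h1

theorem exists_weight (𝒟 : FormDomain) {ϖ : ℂ → ℂ} (hm : Measurable ϖ) {C : ℝ}
    (hC : ∀ z, ‖ϖ z‖ ≤ C) (h0 : ϖ 0 = 1) (hc : ContinuousAt ϖ 0) :
    ∃ w : Weight 𝒟, w.toFun = ϖ := by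
  refine ⟨⟨ϖ, h0, hc, ?_⟩, rfl⟩
  rintro _ ⟨φ, _, rfl⟩ _ ⟨ψ, _, rfl⟩
  exact (integrable_inner_D φ ψ).bdd_mul hm.aestronglyMeasurable (Eventually.of_forall hC)

end

end WHQuant

open WHQuant in
theorem mainTheorem3 (𝒟 : FormDomain) :
    (∀ ϖ : Weight 𝒟, IsRegularWeight ϖ.toFun →
      -- `A_z = a` and `A_{z̄} = a†`
      A ϖ (fun z => z) = 𝒟.op lowering ∧
      A ϖ (fun z => conj z) = 𝒟.op raising ∧
      -- `A_{f̄} = A_f†`: for the sesquilinear forms, and for the operators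
      (∀ (f : ℂ → ℂ), ∀ φ ∈ 𝒟.dom, ∀ ψ ∈ 𝒟.dom, ∀ c : ℂ,
        HasForm ϖ.toFun f ψ φ c → HasForm ϖ.toFun (fun z => conj (f z)) φ ψ (conj c)) ∧
      (∀ f : ℂ → ℂ, (A ϖ f).IsFormalAdjoint (A ϖ fun z => conj (f z))) ∧
      (∀ f : ℂ → ℂ, (A ϖ f).domain = 𝒟.dom →
        (A ϖ fun z => conj (f z)) = (A ϖ f).adjoint.domRestrict 𝒟.dom) ∧
      -- `A_q = (a + a†) / √2 = Q` and `A_p = (a - a†) / (i √2) = P`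
      A ϖ (fun z => ((Real.sqrt 2 * z.re : ℝ) : ℂ)) = 𝒟.op Q ∧
      (Real.sqrt 2 : ℂ)⁻¹ • (lowering + raising) = Q ∧
      A ϖ (fun z => ((Real.sqrt 2 * z.im : ℝ) : ℂ)) = 𝒟.op P ∧
      (Complex.I * Real.sqrt 2 : ℂ)⁻¹ • (lowering - raising) = P ∧
      -- the canonical commutation rules
      CommutatorEq (A ϖ fun z => z) (A ϖ fun z => conj z) 𝒟.dom 1 ∧
      CommutatorEq (A ϖ fun z => ((Real.sqrt 2 * z.re : ℝ) : ℂ))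
        (A ϖ fun z => ((Real.sqrt 2 * z.im : ℝ) : ℂ)) 𝒟.dom Complex.I) ∧
    -- every bounded, measurable, even and real function with value `1` at `0`, continuous
    -- at `0`, is such a weight
    (∀ ϖ : ℂ → ℂ, Measurable ϖ → (∃ C : ℝ, ∀ z, ‖ϖ z‖ ≤ C) → ϖ 0 = 1 → ContinuousAt ϖ 0 →
      IsRegularWeight ϖ → ∃ w : Weight 𝒟, w.toFun = ϖ) := by
  refine ⟨fun ϖ hϖ => ?_, fun ϖ hm ⟨C, hC⟩ h0 hc _ => exists_weight 𝒟 hm hC h0 hc⟩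
  have hz : A ϖ (fun z => z) = 𝒟.op lowering :=
    A_eq_op fun _ hφ _ hψ => hasForm_coordinate ϖ hϖ hφ hψ
  have hz' : A ϖ (fun z => conj z) = 𝒟.op raising :=
    A_eq_op fun _ hφ _ hψ => hasForm_conj_coordinate ϖ hϖ hφ hψ
  have hq : A ϖ (fun z => ((Real.sqrt 2 * z.re : ℝ) : ℂ)) = 𝒟.op Q :=
    A_eq_op fun _ hφ _ hψ => hasForm_position ϖ hϖ hφ hψ
  have hp : A ϖ (fun z => ((Real.sqrt 2 * z.im : ℝ) : ℂ)) = 𝒟.op P :=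
    A_eq_op fun _ hφ _ hψ => hasForm_momentum ϖ hϖ hφ hψ
  refine ⟨hz, hz', fun f φ _ ψ _ c h => h.conj_symm hϖ, isFormalAdjoint_A ϖ hϖ,
    A_conj_eq_adjoint ϖ hϖ, hq, position_eq, hp, momentum_eq, ?_, ?_⟩
  · rw [hz, hz']
    exact commutatorEq_op (fun _ => 𝒟.lowering_mem) (fun _ => 𝒟.raising_mem) lowering_raising_sub
  · rw [hq, hp]
    exact commutatorEq_op 𝒟.Q_mem 𝒟.P_mem Q_P_sub_P_Q
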